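/- Let $q\in\mathbb{C}$ with $0<|q|<1$. Write $(x;q)_n:=\prod_{k=0}^{n-1}(1-xq^k)$ for $n\ge 0$ and $(x;q):=\prod_{n=0}^{\infty}(1-q^n x)$. For $j\in\{0,1\}$ let $$f_j(q):=\sum_{n\ge 0}\frac{q^{n^2+jn}}{(-q;q)_n},\qquad \psi_j(q):=\sum_{n+j\ge 1} q^{\binom{n+1}{2}}(-q;q)_{n+j-1}$$ be Ramanujan's fifth-order mock theta functions, where the second sum is over the integers $n\ge 1-j$. Then for each $j\in\{0,1\}$ all the products and series involved converge (the denominators $(-q;q)_n$ being nonzero), and $$(q;q)^2\,(q;q^2)\,\bigl(f_j(q)+2\psi_j(q)\bigr)=\sum_{n\in\mathbb{Z}} q^{\frac{n(5n+2j+1)}{2}}\,(10n+2j+1).$$ -/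

import Mathlib

noncomputable section

/-- The finite `q`-Pochhammer symbol `(x; q)_n = ∏_{k=0}^{n-1} (1 - x q^k)`. -/
def qPochhammer (x q : ℂ) (n : ℕ) : ℂ :=
  ∏ k ∈ Finset.range n, (1 - x * q ^ k)

/-- The infinite product `(x; q) = ∏_{n ≥ 0} (1 - q^n x)`. -/
def qPochhammerInf (x q : ℂ) : ℂ :=
  ∏' n : ℕ, (1 - q ^ n * x)

/-- The general term `q^{n^2 + jn} / (-q; q)_n` of the series `f_j(q)`. -/
def mockFTerm (j : ℕ) (q : ℂ) (n : ℕ) : ℂ :=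
  q ^ (n ^ 2 + j * n) / qPochhammer (-q) q n

/-- The fifth order mock theta function `f_j(q) = ∑_{n ≥ 0} q^{n^2 + jn} / (-q; q)_n`,
meant for `j = 0, 1`. -/
def mockF (j : ℕ) (q : ℂ) : ℂ :=
  ∑' n : ℕ, mockFTerm j q n

/-- The general term `q^{n(n+1)/2} (-q; q)_{n+j-1}` of the series `ψ_j(q)`, indexed by the `n`
with `n + j ≥ 1`. For `j = 0, 1` all such integers `n` are non-negative, and the subtraction
does not truncate. -/
def mockPsiTerm (j : ℕ) (q : ℂ) (n : {n : ℕ // 1 ≤ n + j}) : ℂ :=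
  q ^ ((n : ℕ) + 1).choose 2 * qPochhammer (-q) q ((n : ℕ) + j - 1)

/-- The fifth order mock theta function
`ψ_j(q) = ∑_{n + j ≥ 1} q^{n(n+1)/2} (-q; q)_{n+j-1}`, meant for `j = 0, 1`. -/
def mockPsi (j : ℕ) (q : ℂ) : ℂ :=
  ∑' n : {n : ℕ // 1 ≤ n + j}, mockPsiTerm j q n

end

/-! ### Infinite q-products -/

open Filter Topology

/-! Both mock theta functions are halves of one bilateral series. In `bilateralSum q (q ^ j) (-1)`
the terms with n ≥ 0 give (-q;q)_∞ f_j and those with n < 0 give 2 (-q;q)_∞ ψ_j. The engine is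
`thetaProd_mul_bilateralSum`: a theta product in a times the bilateral series equals a
very-well-poised series.

To prove it, both sides are shown to obey the same shift (a, x) → (aq², xq) and the same recurrence
in x. Their difference D therefore does too. At x = 1 these combine into a three-term recurrence in
a alone; divided by the theta product, it has only null solutions that are eventually zero, and the
recurrence carries the zeros back. The shift then gives D(a, q^k) = 0 for all k, and since D is
entire in x, the identity theorem finishes.

For a = b²q^j and x = -b the well-poised series collapses to θ(-b) times a theta-type series Θ(b).
At b = 1 both θ(b²) and Θ vanish; comparing first derivatives there (`deriv_oddTheta_eq`) produces
the weights 10n + 2j + 1. Euler's (q;q²)_∞ (-q;q)_∞ = 1 puts the prefactor in its final form. -/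

theorem multipliable_one_sub_pow_mul {q : ℂ} (hq1 : ‖q‖ < 1) (y : ℂ) :
    Multipliable (fun n : ℕ => 1 - q ^ n * y) := by
  have h : Summable fun n : ℕ => ‖-(q ^ n * y)‖ := by
    simp only [norm_neg, norm_mul, norm_pow]
    exact (summable_geometric_of_lt_one (norm_nonneg _) hq1).mul_right _
  simpa [sub_eq_add_neg] using multipliable_one_add_of_summable h

theorem qPochhammerInf_zero (q : ℂ) : qPochhammerInf 0 q = 1 := by
  simp [qPochhammerInf]

theorem qPochhammerInf_eq_mul {q : ℂ} (hq1 : ‖q‖ < 1) (y : ℂ) :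
    qPochhammerInf y q = (1 - y) * qPochhammerInf (y * q) q := by
  have h : Multipliable (fun n : ℕ => 1 - q ^ (n + 1) * y) := by
    refine (multipliable_one_sub_pow_mul hq1 (y * q)).congr fun n => ?_
    ring
  have h1 := tprod_eq_zero_mul' (f := fun n : ℕ => 1 - q ^ n * y) h
  have h2 : ∏' n : ℕ, (1 - q ^ (n + 1) * y) = qPochhammerInf (y * q) q :=
    tprod_congr fun n => by ring
  rw [h2, pow_zero, one_mul] at h1
  exact h1

theorem qPochhammerInf_ne_zero {q : ℂ} (hq1 : ‖q‖ < 1) {y : ℂ} (hy : ∀ n : ℕ, q ^ n * y ≠ 1) :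
    qPochhammerInf y q ≠ 0 := by
  have h : Summable fun n : ℕ => ‖-(q ^ n * y)‖ := by
    simp only [norm_neg, norm_mul, norm_pow]
    exact (summable_geometric_of_lt_one (norm_nonneg _) hq1).mul_right _
  have := tprod_one_add_ne_zero_of_summable (f := fun n : ℕ => -(q ^ n * y))
    (fun n => by rw [← sub_eq_add_neg, sub_ne_zero]; exact (hy n).symm) h
  simpa [sub_eq_add_neg, qPochhammerInf] using this

theorem differentiable_qPochhammerInf {q : ℂ} (hq1 : ‖q‖ < 1) :
    Differentiable ℂ (fun y => qPochhammerInf y q) := by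
  intro y₀
  have hopen : IsOpen (Metric.ball (0 : ℂ) (‖y₀‖ + 1)) := Metric.isOpen_ball
  have hu : Summable fun n : ℕ => ‖q‖ ^ n * (‖y₀‖ + 1) :=
    (summable_geometric_of_lt_one (norm_nonneg _) hq1).mul_right _
  have h := Summable.hasProdLocallyUniformlyOn_nat_one_add (f := fun n y => -(q ^ n * y)) hopen hu
    (Eventually.of_forall fun n y hy => by
      rw [norm_neg, norm_mul, norm_pow]
      gcongr
      simpa using (Metric.mem_ball.mp hy).le) (fun n => by fun_prop)
  have hd := h.differentiableOn (.of_forall fun s => by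
      simpa [Finset.prod_fn] using DifferentiableOn.finsetProd (fun _ _ ↦ by fun_prop)) hopen
  have := hd.differentiableAt (hopen.mem_nhds (x := y₀) (by simp))
  simpa [qPochhammerInf, sub_eq_add_neg] using this

theorem continuous_qPochhammerInf {q : ℂ} (hq1 : ‖q‖ < 1) :
    Continuous (fun y => qPochhammerInf y q) :=
  (differentiable_qPochhammerInf hq1).continuous

theorem qPochhammerInf_eq_qPochhammer_mul {q : ℂ} (hq1 : ‖q‖ < 1) (y : ℂ) (n : ℕ) :
    qPochhammerInf y q = qPochhammer y q n * qPochhammerInf (y * q ^ n) q := by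
  induction n with
  | zero => simp [qPochhammer]
  | succ n ih =>
    rw [ih, qPochhammerInf_eq_mul hq1 (y * q ^ n), qPochhammer, qPochhammer,
      Finset.prod_range_succ, pow_succ]
    ring_nf

/-- Euler's identity `(q; q²)_∞ (-q; q)_∞ = 1`. -/
theorem qPochhammerInf_odd_mul_qPochhammerInf_neg {q : ℂ} (hq1 : ‖q‖ < 1) :
    qPochhammerInf q (q ^ 2) * qPochhammerInf (-q) q = 1 := by
  have hq2 : ‖q ^ 2‖ < 1 := by
    rw [norm_pow]; exact pow_lt_one₀ (norm_nonneg _) hq1 two_ne_zero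
  have h1 : qPochhammerInf q (q ^ 2) * qPochhammerInf (q ^ 2) (q ^ 2) = qPochhammerInf q q := by
    have := tprod_even_mul_odd (f := fun n : ℕ => 1 - q ^ n * q)
      ((multipliable_one_sub_pow_mul hq2 q).congr fun n => by rw [pow_mul])
      ((multipliable_one_sub_pow_mul hq2 (q ^ 2)).congr fun n => by rw [← pow_mul]; ring)
    rw [qPochhammerInf, qPochhammerInf, qPochhammerInf, ← this]
    congr 2 <;> ext n <;> rw [← pow_mul]
    ring
  have h2 : qPochhammerInf q q * qPochhammerInf (-q) q = qPochhammerInf (q ^ 2) (q ^ 2) := by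
    rw [qPochhammerInf, qPochhammerInf, qPochhammerInf, ← (multipliable_one_sub_pow_mul hq1 q).tprod_mul
      (multipliable_one_sub_pow_mul hq1 (-q))]
    congr 1
    ext n
    ring
  have h3 : qPochhammerInf q q ≠ 0 := by
    refine qPochhammerInf_ne_zero hq1 fun n h => ?_
    have := congrArg norm h
    rw [← pow_succ, norm_pow, norm_one] at this
    exact (pow_lt_one₀ (norm_nonneg _) hq1 n.succ_ne_zero).ne this
  have h4 : qPochhammerInf (q ^ 2) (q ^ 2) ≠ 0 := fun h => h3 (by rw [← h1, h, mul_zero])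
  refine mul_right_cancel₀ h4 ?_
  rw [mul_right_comm, h1, h2, one_mul]

/-! ### Growth estimates -/

theorem summable_pow_mul_sq {s : ℝ} (hs0 : 0 ≤ s) (hs1 : s < 1) (K : ℝ) (hK : 0 ≤ K) :
    Summable fun n : ℕ => K ^ n * s ^ (n ^ 2) := by
  have ht : Tendsto (fun n : ℕ => K * s ^ n) atTop (𝓝 (K * 0)) :=
    (tendsto_pow_atTop_nhds_zero_of_lt_one hs0 hs1).const_mul K
  rw [mul_zero] at ht
  refine Summable.of_norm_bounded_eventually_nat
    (summable_geometric_of_lt_one (r := 1 / 2) (by norm_num) (by norm_num)) ?_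
  filter_upwards [ht.eventually_le_const (show (0 : ℝ) < 1 / 2 by norm_num)] with n hn
  rw [Real.norm_of_nonneg (by positivity), pow_two, pow_mul, ← mul_pow]
  gcongr

theorem summable_pow_natAbs_mul_sq {s : ℝ} (hs0 : 0 ≤ s) (hs1 : s < 1) (K : ℝ) (hK : 0 ≤ K) :
    Summable fun n : ℤ => K ^ n.natAbs * s ^ (n.natAbs ^ 2) := by
  have h := summable_pow_mul_sq hs0 hs1 K hK
  exact Summable.of_nat_of_neg (by simpa using h) (by simpa using h)

theorem norm_zpow_le_pow_natAbs {a : ℂ} {A : ℝ} (h1 : ‖a‖ ≤ A) (h2 : ‖a⁻¹‖ ≤ A) (n : ℤ) :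
    ‖a ^ n‖ ≤ A ^ n.natAbs := by
  obtain ⟨m, rfl | rfl⟩ := n.eq_nat_or_neg
  · rw [zpow_natCast, norm_pow, Int.natAbs_natCast]
    gcongr
  · rw [zpow_neg, zpow_natCast, ← inv_pow, norm_pow, Int.natAbs_neg, Int.natAbs_natCast]
    gcongr

/-- Growth of `(y; q)_∞` along the orbit `y q^ℤ`, with `s = √|q|`. -/
theorem exists_norm_qPochhammerInf_zpow_le {q : ℂ} (hq0 : 0 < ‖q‖) (hq1 : ‖q‖ < 1) (ρ : ℝ) :
    ∃ C K : ℝ, 0 ≤ C ∧ 1 ≤ K ∧ ∀ y : ℂ, ‖y‖ ≤ ρ → ∀ n : ℤ,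
      ‖qPochhammerInf (y * q ^ n) q‖ * √‖q‖ ^ (n.natAbs ^ 2) ≤ C * K ^ n.natAbs := by
  have hq : q ≠ 0 := norm_pos_iff.mp hq0
  obtain ⟨C, hC⟩ := (isCompact_closedBall (0 : ℂ) ρ).exists_bound_of_continuousOn
    (continuous_qPochhammerInf hq1).continuousOn
  have hs0 : 0 < √‖q‖ := Real.sqrt_pos.mpr hq0
  have hs1 : √‖q‖ < 1 := by rw [Real.sqrt_lt' one_pos]; simpa using hq1
  have hsq : √‖q‖ ^ 2 = ‖q‖ := Real.sq_sqrt hq0.le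
  set s := √‖q‖
  by_cases hρ : 0 ≤ ρ
  swap
  · exact ⟨0, 1, le_rfl, le_rfl, fun y hy => absurd ((norm_nonneg y).trans hy) hρ⟩
  have hC' : ∀ y : ℂ, ‖y‖ ≤ ρ → ‖qPochhammerInf y q‖ ≤ C := fun y hy => hC y (by simpa using hy)
  have hC0 : 0 ≤ C := (norm_nonneg _).trans (hC' 0 (by simpa using hρ))
  have hK : 1 ≤ (1 + ρ) / s := by
    rw [le_div_iff₀ hs0]; linarith
  refine ⟨C, (1 + ρ) / s, hC0, hK, fun y hy n => ?_⟩
  have hneg : ∀ m : ℕ, ‖qPochhammerInf (y * q ^ (-(m : ℤ))) q‖ * s ^ (m ^ 2) ≤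
      C * ((1 + ρ) / s) ^ m := by
    intro m
    induction m with
    | zero => simpa using hC' y hy
    | succ m ih =>
      have e : y * q ^ (-((m + 1 : ℕ) : ℤ)) * q = y * q ^ (-(m : ℤ)) := by
        rw [mul_assoc, ← zpow_add_one₀ hq]; congr 2; push_cast; ring
      rw [qPochhammerInf_eq_mul hq1, e, norm_mul]
      -- Since (m+1)² - m² = 2m + 1 and s^(2m+2) = |q|^(m+1), the added Gaussian weight pays for the
      -- new factor up to the constant (1 + ρ)/s.
      have h1 : ‖1 - y * q ^ (-((m + 1 : ℕ) : ℤ))‖ * s ^ (2 * m + 1) ≤ (1 + ρ) / s := by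
        rw [le_div_iff₀ hs0, mul_assoc, ← pow_succ, show 2 * m + 1 + 1 = 2 * (m + 1) by ring,
          pow_mul, hsq]
        have h2 : ‖1 - y * q ^ (-((m + 1 : ℕ) : ℤ))‖ ≤ 1 + ρ * (‖q‖ ^ (m + 1))⁻¹ := by
          refine (norm_sub_le _ _).trans ?_
          rw [norm_one, norm_mul, zpow_neg, zpow_natCast, norm_inv, norm_pow]
          gcongr
        have hp : 0 < ‖q‖ ^ (m + 1) := by positivity
        calc _ ≤ (1 + ρ * (‖q‖ ^ (m + 1))⁻¹) * ‖q‖ ^ (m + 1) := by gcongr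
          _ = ‖q‖ ^ (m + 1) + ρ := by field_simp
          _ ≤ 1 + ρ := by gcongr; exact pow_le_one₀ hq0.le hq1.le
      calc _ = (‖1 - y * q ^ (-((m + 1 : ℕ) : ℤ))‖ * s ^ (2 * m + 1)) *
            (‖qPochhammerInf (y * q ^ (-(m : ℤ))) q‖ * s ^ (m ^ 2)) := by ring
        _ ≤ (1 + ρ) / s * (C * ((1 + ρ) / s) ^ m) := by gcongr
        _ = _ := by ring
  rcases n.natAbs_eq with h | h
  · have h1 : ‖qPochhammerInf (y * q ^ n) q‖ ≤ C := by
      refine hC' _ ?_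
      rw [h, zpow_natCast, norm_mul, norm_pow]
      exact (mul_le_of_le_one_right (norm_nonneg _) (pow_le_one₀ hq0.le hq1.le)).trans hy
    calc _ ≤ C * 1 := by gcongr; exact pow_le_one₀ hs0.le hs1.le
      _ ≤ _ := by gcongr; exact one_le_pow₀ hK
  · have := hneg n.natAbs
    rwa [← h] at this

/-! ### The two bilateral series and their majorants -/

noncomputable section

/-- The general term of `∑_{n ∈ ℤ} q^{n²} aⁿ (x q^{n+1}; q)_∞`. -/
def bilateralTerm (q a x : ℂ) (n : ℤ) : ℂ :=
  q ^ (n ^ 2) * a ^ n * qPochhammerInf (x * q * q ^ n) q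

/-- The general term of the well-poised series
`∑_{r ∈ ℤ} (1 - a q^{2r}) a^{3r} q^{3r² - r} (x q^{1-r} / a; q)_∞ (x q^{1+r}; q)_∞`. -/
def wellPoisedTerm (q a x : ℂ) (r : ℤ) : ℂ :=
  (1 - a * q ^ (2 * r)) * a ^ (3 * r) * q ^ (3 * r ^ 2 - r) *
    (qPochhammerInf (x * q / a * q ^ (-r)) q * qPochhammerInf (x * q * q ^ r) q)

/-- `wellPoisedTerm` without its very-well-poised factor `1 - a q^{2r}`. -/
def wellPoisedCore (q a x : ℂ) (r : ℤ) : ℂ :=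
  a ^ (3 * r) * q ^ (3 * r ^ 2 - r) *
    (qPochhammerInf (x * q / a * q ^ (-r)) q * qPochhammerInf (x * q * q ^ r) q)

def bilateralSum (q a x : ℂ) : ℂ := ∑' n : ℤ, bilateralTerm q a x n

def wellPoisedSum (q a x : ℂ) : ℂ := ∑' r : ℤ, wellPoisedTerm q a x r

/-- The theta product `(w; q)_∞ (q / w; q)_∞`. -/
def thetaProd (q w : ℂ) : ℂ := qPochhammerInf w q * qPochhammerInf (q / w) q

end

theorem norm_zpow_sq_eq {q : ℂ} (n : ℤ) : ‖q ^ (n ^ 2)‖ = √‖q‖ ^ (n.natAbs ^ 2) * √‖q‖ ^ (n.natAbs ^ 2) := by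
  rw [← mul_pow, Real.mul_self_sqrt (norm_nonneg _), ← Int.natAbs_sq n]
  rw [← Nat.cast_pow, zpow_natCast, norm_pow]

/-- With s = √|q|, |q^(n²)| is s^(n²) squared: one copy absorbs the growth of the infinite product,
the other secures convergence. Uniformity in a and x is what later gives holomorphy of the sums. -/
theorem exists_summable_bound_bilateralTerm {q : ℂ} (hq0 : 0 < ‖q‖) (hq1 : ‖q‖ < 1) (A ρ : ℝ)
    (hA : 0 ≤ A) :
    ∃ u : ℤ → ℝ, Summable u ∧ ∀ a x : ℂ, ‖a‖ ≤ A → ‖a⁻¹‖ ≤ A → ‖x‖ ≤ ρ →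
      ∀ n, ‖bilateralTerm q a x n‖ ≤ u n := by
  obtain ⟨C, K, hC, hK, h⟩ := exists_norm_qPochhammerInf_zpow_le hq0 hq1 ρ
  have hs0 : 0 < √‖q‖ := Real.sqrt_pos.mpr hq0
  have hs1 : √‖q‖ < 1 := by rw [Real.sqrt_lt' one_pos]; simpa using hq1
  refine ⟨fun n => C * ((A * K) ^ n.natAbs * √‖q‖ ^ (n.natAbs ^ 2)),
    (summable_pow_natAbs_mul_sq hs0.le hs1 (A * K) (by positivity)).mul_left C,
    fun a x h1 h2 hx n => ?_⟩
  have hxq : ‖x * q‖ ≤ ρ := by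
    rw [norm_mul]; exact (mul_le_of_le_one_right (norm_nonneg _) hq1.le).trans hx
  have hE := h (x * q) hxq n
  rw [bilateralTerm, norm_mul, norm_mul, norm_zpow_sq_eq]
  set s := √‖q‖ ^ (n.natAbs ^ 2)
  have hs : 0 < s := by positivity
  calc _ = s * ‖a ^ n‖ * (‖qPochhammerInf (x * q * q ^ n) q‖ * s) := by ring
    _ ≤ s * A ^ n.natAbs * (C * K ^ n.natAbs) := by
      gcongr; exact norm_zpow_le_pow_natAbs h1 h2 n
    _ = _ := by ring

theorem exists_summable_bound_wellPoisedTerm {q : ℂ} (hq0 : 0 < ‖q‖) (hq1 : ‖q‖ < 1) (A ρ : ℝ)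
    (hA : 0 ≤ A) :
    ∃ u : ℤ → ℝ, Summable u ∧ ∀ a x : ℂ, ‖a‖ ≤ A → ‖a⁻¹‖ ≤ A → ‖x‖ ≤ ρ →
      ∀ n, ‖wellPoisedCore q a x n‖ ≤ u n ∧ ‖wellPoisedTerm q a x n‖ ≤ u n := by
  obtain ⟨C, K, hC, hK, h⟩ := exists_norm_qPochhammerInf_zpow_le hq0 hq1 (max ρ (ρ * A))
  have hs0 : 0 < √‖q‖ := Real.sqrt_pos.mpr hq0
  have hs1 : √‖q‖ < 1 := by rw [Real.sqrt_lt' one_pos]; simpa using hq1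
  set p := ‖q‖⁻¹ with hp
  have hp1 : 1 ≤ p := (one_le_inv₀ hq0).mpr hq1.le
  refine ⟨fun n => (1 + A) * C ^ 2 * ((p ^ 2 * A ^ 3 * p * K ^ 2) ^ n.natAbs * √‖q‖ ^ (n.natAbs ^ 2)),
    (summable_pow_natAbs_mul_sq hs0.le hs1 _ (by positivity)).mul_left _,
    fun a x h1 h2 hx n => ?_⟩
  have hρ : 0 ≤ ρ := (norm_nonneg _).trans hx
  have hxq : ‖x * q‖ ≤ ρ := by
    rw [norm_mul]; exact (mul_le_of_le_one_right (norm_nonneg _) hq1.le).trans hx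
  have hE := h (x * q) (hxq.trans (le_max_left _ _)) n
  have hE' := h (x * q / a) (by
    rw [div_eq_mul_inv, norm_mul]
    exact (mul_le_mul hxq h2 (norm_nonneg _) hρ).trans (le_max_right _ _)) (-n)
  rw [Int.natAbs_neg] at hE'
  have hqz : ∀ k : ℤ, ‖q ^ k‖ ≤ p ^ k.natAbs := norm_zpow_le_pow_natAbs
    (hq1.le.trans hp1) (by rw [norm_inv])
  have hq0' : q ≠ 0 := norm_pos_iff.mp hq0
  have e1 : ‖1 - a * q ^ (2 * n)‖ ≤ (1 + A) * (p ^ 2) ^ n.natAbs := by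
    have := hqz (2 * n)
    rw [Int.natAbs_mul, pow_mul] at this
    calc _ ≤ 1 + ‖a‖ * ‖q ^ (2 * n)‖ := by
          refine (norm_sub_le _ _).trans ?_
          rw [norm_one, norm_mul]
      _ ≤ (p ^ 2) ^ n.natAbs + A * (p ^ 2) ^ n.natAbs := by
          gcongr
          · exact one_le_pow₀ (one_le_pow₀ hp1)
          · exact this
      _ = _ := by ring
  have e2 : ‖a ^ (3 * n)‖ ≤ (A ^ 3) ^ n.natAbs := by
    have := norm_zpow_le_pow_natAbs h1 h2 (3 * n)
    rwa [Int.natAbs_mul, pow_mul] at this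
  -- Three of the six available Gaussian factors suffice: one for each infinite product and one for
  -- convergence.
  have e3 : ‖q ^ (3 * n ^ 2 - n)‖ ≤ (√‖q‖ ^ (n.natAbs ^ 2)) ^ 3 * p ^ n.natAbs := by
    have h3 : q ^ (3 * n ^ 2 - n) = (q ^ (n ^ 2)) ^ 3 * q ^ (-n) := by
      rw [← zpow_natCast, ← zpow_mul, ← zpow_add₀ hq0']; congr 1; push_cast; ring
    rw [h3, norm_mul, norm_pow, norm_zpow_sq_eq]
    have := hqz (-n)
    rw [Int.natAbs_neg] at this
    have hs : √‖q‖ ^ (n.natAbs ^ 2) ≤ 1 := pow_le_one₀ hs0.le hs1.le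
    gcongr
    exact mul_le_of_le_one_right (by positivity) hs
  have e0 : ‖(1 : ℂ)‖ ≤ (1 + A) * (p ^ 2) ^ n.natAbs := by
    rw [norm_one]
    exact one_le_mul_of_one_le_of_one_le (by linarith) (one_le_pow₀ (one_le_pow₀ hp1))
  suffices key : ∀ c : ℂ, ‖c‖ ≤ (1 + A) * (p ^ 2) ^ n.natAbs →
      ‖c * a ^ (3 * n) * q ^ (3 * n ^ 2 - n) * (qPochhammerInf (x * q / a * q ^ (-n)) q *
        qPochhammerInf (x * q * q ^ n) q)‖ ≤ (1 + A) * C ^ 2 *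
          ((p ^ 2 * A ^ 3 * p * K ^ 2) ^ n.natAbs * √‖q‖ ^ (n.natAbs ^ 2)) from
    ⟨by simpa only [wellPoisedCore, one_mul] using key 1 e0, key _ e1⟩
  intro c hc
  rw [norm_mul, norm_mul, norm_mul, norm_mul]
  set s := √‖q‖ ^ (n.natAbs ^ 2)
  have hs : 0 < s := by positivity
  calc _ ≤ (1 + A) * (p ^ 2) ^ n.natAbs * (A ^ 3) ^ n.natAbs * (s ^ 3 * p ^ n.natAbs) *
        (‖qPochhammerInf (x * q / a * q ^ (-n)) q‖ * ‖qPochhammerInf (x * q * q ^ n) q‖) := by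
        gcongr
    _ = (1 + A) * (p ^ 2 * A ^ 3 * p) ^ n.natAbs * s *
        ((‖qPochhammerInf (x * q / a * q ^ (-n)) q‖ * s) *
          (‖qPochhammerInf (x * q * q ^ n) q‖ * s)) := by ring
    _ ≤ (1 + A) * (p ^ 2 * A ^ 3 * p) ^ n.natAbs * s *
        ((C * K ^ n.natAbs) * (C * K ^ n.natAbs)) := by gcongr
    _ = _ := by ring

theorem summable_bilateralTerm {q : ℂ} (hq0 : 0 < ‖q‖) (hq1 : ‖q‖ < 1) (a x : ℂ) :
    Summable (bilateralTerm q a x) := by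
  obtain ⟨u, hu, h⟩ := exists_summable_bound_bilateralTerm hq0 hq1 (max ‖a‖ ‖a⁻¹‖) ‖x‖
    (by positivity)
  exact hu.of_norm_bounded fun n => (h a x (le_max_left _ _) (le_max_right _ _) le_rfl n)

theorem summable_wellPoisedTerm {q : ℂ} (hq0 : 0 < ‖q‖) (hq1 : ‖q‖ < 1) (a x : ℂ) :
    Summable (wellPoisedTerm q a x) := by
  obtain ⟨u, hu, h⟩ := exists_summable_bound_wellPoisedTerm hq0 hq1 (max ‖a‖ ‖a⁻¹‖) ‖x‖
    (by positivity)
  exact hu.of_norm_bounded fun n => (h a x (le_max_left _ _) (le_max_right _ _) le_rfl n).2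

theorem summable_wellPoisedCore {q : ℂ} (hq0 : 0 < ‖q‖) (hq1 : ‖q‖ < 1) (a x : ℂ) :
    Summable (wellPoisedCore q a x) := by
  obtain ⟨u, hu, h⟩ := exists_summable_bound_wellPoisedTerm hq0 hq1 (max ‖a‖ ‖a⁻¹‖) ‖x‖
    (by positivity)
  exact hu.of_norm_bounded fun n => (h a x (le_max_left _ _) (le_max_right _ _) le_rfl n).1

/-! ### Functional equations in a and x -/

theorem thetaProd_mul {q : ℂ} (hq0 : 0 < ‖q‖) (hq1 : ‖q‖ < 1) {w : ℂ} (hw : w ≠ 0) :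
    thetaProd q w = -w * thetaProd q (w * q) := by
  have hq : q ≠ 0 := norm_pos_iff.mp hq0
  have e1 : q / (w * q) = w⁻¹ := by field_simp
  have e2 : w⁻¹ * q = q / w := by ring
  rw [thetaProd, thetaProd, qPochhammerInf_eq_mul hq1 w, e1, qPochhammerInf_eq_mul hq1 w⁻¹, e2]
  field_simp
  ring

theorem bilateralSum_shift {q : ℂ} (hq0 : 0 < ‖q‖) {a : ℂ} (ha : a ≠ 0) (x : ℂ) :
    bilateralSum q a x = q * a * bilateralSum q (a * q ^ 2) (x * q) := by
  have hq : q ≠ 0 := norm_pos_iff.mp hq0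
  rw [bilateralSum, bilateralSum, ← (Equiv.addRight (1 : ℤ)).tsum_eq, ← tsum_mul_left]
  congr 1
  ext n
  simp only [bilateralTerm, Equiv.coe_addRight]
  have e1 : x * q * q ^ (n + 1) = x * q * q * q ^ n := by rw [zpow_add_one₀ hq]; ring
  have e2 : q ^ ((n + 1) ^ 2) = q * q ^ (n ^ 2) * (q ^ 2) ^ n := by
    rw [← zpow_natCast, ← zpow_mul, ← zpow_one_add₀ hq, ← zpow_add₀ hq]; congr 1; push_cast; ring
  rw [e1, e2, zpow_add_one₀ ha, mul_zpow]
  ring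

theorem wellPoisedSum_shift {q : ℂ} (hq0 : 0 < ‖q‖) {a : ℂ} (ha : a ≠ 0) (x : ℂ) :
    wellPoisedSum q a x = q ^ 2 * a ^ 3 * wellPoisedSum q (a * q ^ 2) (x * q) := by
  have hq : q ≠ 0 := norm_pos_iff.mp hq0
  rw [wellPoisedSum, wellPoisedSum, ← (Equiv.addRight (1 : ℤ)).tsum_eq, ← tsum_mul_left]
  congr 1
  ext r
  simp only [wellPoisedTerm, Equiv.coe_addRight]
  have e1 : x * q * q ^ (r + 1) = x * q * q * q ^ r := by rw [zpow_add_one₀ hq]; ring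
  have e2 : x * q / a * q ^ (-(r + 1)) = x * q * q / (a * q ^ 2) * q ^ (-r) := by
    rw [neg_add, zpow_add₀ hq]; simp only [zpow_neg_one]; field_simp
  have e3 : q ^ (2 * (r + 1)) = q ^ 2 * q ^ (2 * r) := by
    rw [← zpow_natCast, ← zpow_add₀ hq]; congr 1; push_cast; ring
  have e4 : q ^ (3 * (r + 1) ^ 2 - (r + 1)) = q ^ 2 * q ^ (3 * r ^ 2 - r) * (q ^ 2) ^ (3 * r) := by
    rw [← zpow_natCast, ← zpow_mul, ← zpow_add₀ hq, ← zpow_add₀ hq]; congr 1; push_cast; ring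
  have e5 : a ^ (3 * (r + 1)) = a ^ 3 * a ^ (3 * r) := by
    rw [← zpow_natCast, ← zpow_add₀ ha]; congr 1; push_cast; ring
  rw [e1, e2, e3, e4, e5, mul_zpow]
  ring

theorem bilateralSum_recurrence {q : ℂ} (hq0 : 0 < ‖q‖) (hq1 : ‖q‖ < 1) (a x : ℂ) :
    bilateralSum q a x = bilateralSum q a (x * q) - x * q * bilateralSum q (a * q) (x * q) := by
  have hq : q ≠ 0 := norm_pos_iff.mp hq0
  rw [bilateralSum, bilateralSum, bilateralSum, ← tsum_mul_left,
    ← (summable_bilateralTerm hq0 hq1 _ _).tsum_sub ((summable_bilateralTerm hq0 hq1 _ _).mul_left _)]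
  congr 1
  ext n
  simp only [bilateralTerm]
  rw [qPochhammerInf_eq_mul hq1 (x * q * q ^ n), mul_zpow,
    show x * q * q ^ n * q = x * q * q * q ^ n by ring]
  ring

/-- The factor 1 - aq^(2r+1) splits the last series into U - V. The recurrence holds term by term
once V(r) is replaced by V(r-1), which leaves the sum over ℤ unchanged. -/
theorem wellPoisedSum_recurrence {q : ℂ} (hq0 : 0 < ‖q‖) (hq1 : ‖q‖ < 1) {a : ℂ} (ha : a ≠ 0)
    (x : ℂ) :
    wellPoisedSum q a x =
      wellPoisedSum q a (x * q) + x * q * a * wellPoisedSum q (a * q) (x * q) := by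
  have hq : q ≠ 0 := norm_pos_iff.mp hq0
  set U : ℤ → ℂ := fun r => x * q * a * wellPoisedCore q (a * q) (x * q) r with hU
  set V : ℤ → ℂ := fun r => a * q ^ (2 * r + 1) * U r with hV
  have hUV : ∀ r, x * q * a * wellPoisedTerm q (a * q) (x * q) r = U r - V r := by
    intro r
    simp only [hU, hV, wellPoisedCore, wellPoisedTerm, zpow_add_one₀ hq]
    ring
  have hUs : Summable U := (summable_wellPoisedCore hq0 hq1 _ _).mul_left _
  have hVs : Summable V := by
    have := hUs.sub ((summable_wellPoisedTerm hq0 hq1 (a * q) (x * q)).mul_left (x * q * a))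
    exact this.congr fun r => by rw [hUV]; ring
  have hVs' : Summable fun r => V (r - 1) := (Equiv.subRight (1 : ℤ)).summable_iff.mpr hVs
  have hdiff : ∀ r, wellPoisedTerm q a x r = wellPoisedTerm q a (x * q) r + (U r - V (r - 1)) := by
    intro r
    have c1 : x * q / a * q ^ (-r) * q = x * q * q / a * q ^ (-r) := by ring
    have c2 : x * q * q ^ r * q = x * q * q * q ^ r := by ring
    have c3 : x * q * q / (a * q) * q ^ (-r) = x * q / a * q ^ (-r) := by field_simp
    have c4 : x * q / a * q ^ (-(r - 1)) = x * q * q / a * q ^ (-r) := by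
      rw [neg_sub, sub_eq_add_neg, zpow_one_add₀ hq]; ring
    have c5 : x * q * q * q ^ (r - 1) = x * q * q ^ r := by
      rw [zpow_sub_one₀ hq]; field_simp
    have hz : q ^ r ≠ 0 := zpow_ne_zero _ hq
    have d1 : q ^ (3 * (r - 1) ^ 2 - (r - 1)) = q ^ 4 * q ^ (3 * r ^ 2 - r) * (q ^ r)⁻¹ ^ 6 := by
      rw [← zpow_neg, ← zpow_natCast, ← zpow_natCast, ← zpow_mul, ← zpow_add₀ hq, ← zpow_add₀ hq]
      congr 1; push_cast; ring
    have d2 : q ^ (2 * (r - 1) + 1) = q⁻¹ * (q ^ r) ^ 2 := by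
      rw [← zpow_neg_one, ← zpow_natCast, ← zpow_mul, ← zpow_add₀ hq]; congr 1; push_cast; ring
    have d3 : q ^ (2 * r) = (q ^ r) ^ 2 := by
      rw [← zpow_natCast, ← zpow_mul]; congr 1; push_cast; ring
    have d4 : (a * q) ^ (3 * (r - 1)) = (a⁻¹) ^ 3 * (q⁻¹) ^ 3 * (a ^ (3 * r) * (q ^ r) ^ 3) := by
      rw [mul_zpow, mul_sub, zpow_sub₀ ha, zpow_sub₀ hq, ← zpow_natCast (q ^ r), ← zpow_mul]
      rw [mul_comm r]
      norm_cast
      field_simp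
    have d5 : (a * q) ^ (3 * r) = a ^ (3 * r) * (q ^ r) ^ 3 := by
      rw [mul_zpow, ← zpow_natCast (q ^ r), ← zpow_mul, mul_comm r]; norm_cast
    simp only [hU, hV, wellPoisedCore, wellPoisedTerm]
    rw [qPochhammerInf_eq_mul hq1 (x * q / a * q ^ (-r)), qPochhammerInf_eq_mul hq1 (x * q * q ^ r),
      c1, c2, c3, mul_div_mul_right _ _ hq, c4, c5, qPochhammerInf_eq_mul hq1 (x * q / a * q ^ (-r)),
      qPochhammerInf_eq_mul hq1 (x * q * q ^ r), c1, c2, d1, d2, d3, d4, d5, zpow_neg]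
    generalize qPochhammerInf (x * q * q / a * (q ^ r)⁻¹) q = P
    generalize qPochhammerInf (x * q * q * q ^ r) q = Q
    generalize q ^ (3 * r ^ 2 - r) = w
    generalize a ^ (3 * r) = v
    generalize q ^ r = z at hz
    field_simp
    ring
  have hVsum : ∑' r, V (r - 1) = ∑' r, V r := (Equiv.subRight (1 : ℤ)).tsum_eq V
  rw [wellPoisedSum, wellPoisedSum, wellPoisedSum, ← tsum_mul_left, tsum_congr hUV, hUs.tsum_sub hVs,
    ← hVsum, ← hUs.tsum_sub hVs', ← (summable_wellPoisedTerm hq0 hq1 _ _).tsum_add (hUs.sub hVs')]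
  exact tsum_congr hdiff

/-! ### Vanishing of the defect at x = 1 -/

noncomputable section

def bilateralDefect (q a x : ℂ) : ℂ := thetaProd q a * bilateralSum q a x - wellPoisedSum q a x

/-- General term of the Rogers–Ramanujan type power series in `a` obtained at `x = 1`. -/
def truncatedTerm (q a : ℂ) (n : ℕ) : ℂ := q ^ (n ^ 2) * a ^ n * qPochhammerInf (q * q ^ n) q

/-- What remains of the well-poised term at x = 1 after (q/a;q)_∞ is pulled out. It is polynomial in
a, so the limit a → 0 makes sense. -/
def truncatedWellPoisedTerm (q a : ℂ) (m : ℕ) : ℂ :=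
  (1 - a * q ^ (2 * m)) * a ^ (2 * m) * q ^ (2 * m ^ 2 + m * (m - 1)) *
    (∏ k ∈ Finset.range m, (a - (q ^ k)⁻¹)) * qPochhammerInf (q * q ^ m) q

def truncatedDefect (q a : ℂ) : ℂ :=
  qPochhammerInf a q * ∑' n, truncatedTerm q a n - ∑' m, truncatedWellPoisedTerm q a m

end

theorem bilateralDefect_shift {q : ℂ} (hq0 : 0 < ‖q‖) (hq1 : ‖q‖ < 1) {a : ℂ} (ha : a ≠ 0) (x : ℂ) :
    bilateralDefect q a x = q ^ 2 * a ^ 3 * bilateralDefect q (a * q ^ 2) (x * q) := by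
  have hq : q ≠ 0 := norm_pos_iff.mp hq0
  rw [bilateralDefect, bilateralDefect, bilateralSum_shift hq0 ha, wellPoisedSum_shift hq0 ha,
    thetaProd_mul hq0 hq1 ha, thetaProd_mul hq0 hq1 (mul_ne_zero ha hq), pow_two q, ← mul_assoc a]
  ring

/-- The coefficients -xq and xqa of the two recurrences are reconciled by θ(a) = -aθ(aq). -/
theorem bilateralDefect_recurrence {q : ℂ} (hq0 : 0 < ‖q‖) (hq1 : ‖q‖ < 1) {a : ℂ} (ha : a ≠ 0)
    (x : ℂ) :
    bilateralDefect q a x =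
      bilateralDefect q a (x * q) + x * q * a * bilateralDefect q (a * q) (x * q) := by
  simp only [bilateralDefect]
  rw [bilateralSum_recurrence hq0 hq1, wellPoisedSum_recurrence hq0 hq1 ha]
  linear_combination (-x * q * bilateralSum q (a * q) (x * q)) * thetaProd_mul hq0 hq1 ha

theorem bilateralDefect_one_recurrence {q : ℂ} (hq0 : 0 < ‖q‖) (hq1 : ‖q‖ < 1) {a : ℂ} (ha : a ≠ 0) :
    bilateralDefect q a 1 =
      q ^ 2 * a ^ 3 * bilateralDefect q (a * q ^ 2) 1 - a * bilateralDefect q (a * q) 1 := by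
  have hq : q ≠ 0 := norm_pos_iff.mp hq0
  have h1 := bilateralDefect_recurrence hq0 hq1 (a := a * q ^ 2) (mul_ne_zero ha (pow_ne_zero 2 hq)) 1
  have h2 := bilateralDefect_shift hq0 hq1 ha 1
  have h3 := bilateralDefect_shift hq0 hq1 (mul_ne_zero ha hq) 1
  rw [show a * q * q ^ 2 = a * q ^ 2 * q by ring] at h3
  rw [h2, h3, h1]
  ring

theorem qPochhammerInf_zpow_neg {q : ℂ} (hq0 : 0 < ‖q‖) (hq1 : ‖q‖ < 1) (m : ℕ) :
    qPochhammerInf (q ^ (-(m : ℤ))) q = 0 := by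
  have hq : q ≠ 0 := norm_pos_iff.mp hq0
  rw [qPochhammerInf_eq_qPochhammer_mul hq1 _ (m + 1), qPochhammer,
    Finset.prod_eq_zero (Finset.self_mem_range_succ m), zero_mul]
  rw [zpow_neg, zpow_natCast, inv_mul_cancel₀ (pow_ne_zero _ hq), sub_self]

theorem qPochhammerInf_mul_zpow_of_neg {q : ℂ} (hq0 : 0 < ‖q‖) (hq1 : ‖q‖ < 1) {n : ℤ} (hn : n < 0) :
    qPochhammerInf (q * q ^ n) q = 0 := by
  have hq : q ≠ 0 := norm_pos_iff.mp hq0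
  obtain ⟨m, hm⟩ := Int.eq_ofNat_of_zero_le (show 0 ≤ -(n + 1) by omega)
  rw [← zpow_one_add₀ hq, show 1 + n = -(m : ℤ) by omega]
  exact qPochhammerInf_zpow_neg hq0 hq1 m

theorem tsum_int_eq_tsum_nat {f : ℤ → ℂ} (hf : ∀ n < 0, f n = 0) :
    ∑' n, f n = ∑' n : ℕ, f n := by
  refine (Function.Injective.tsum_eq (g := ((↑) : ℕ → ℤ)) Nat.cast_injective fun n hn => ?_).symm
  by_contra h
  refine hn (hf n ?_)
  by_contra h'
  exact h ⟨n.toNat, Int.toNat_of_nonneg (not_lt.mp h')⟩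

theorem bilateralDefect_one_eq {q : ℂ} (hq0 : 0 < ‖q‖) (hq1 : ‖q‖ < 1) {a : ℂ} (ha : a ≠ 0) :
    bilateralDefect q a 1 = qPochhammerInf (q / a) q * truncatedDefect q a := by
  have hq : q ≠ 0 := norm_pos_iff.mp hq0
  have h1 : bilateralSum q a 1 = ∑' n, truncatedTerm q a n := by
    rw [bilateralSum, tsum_int_eq_tsum_nat]
    · refine tsum_congr fun n => ?_
      rw [bilateralTerm, truncatedTerm, one_mul]; norm_cast
    · intro n hn
      rw [bilateralTerm, one_mul, qPochhammerInf_mul_zpow_of_neg hq0 hq1 hn, mul_zero]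
  have h2 : wellPoisedSum q a 1 =
      qPochhammerInf (q / a) q * ∑' n, truncatedWellPoisedTerm q a n := by
    rw [wellPoisedSum, tsum_int_eq_tsum_nat, ← tsum_mul_left]
    · refine tsum_congr fun m => ?_
      have e1 : qPochhammerInf (q / a * q ^ (-(m : ℤ))) q * a ^ m =
          (∏ k ∈ Finset.range m, (a - (q ^ k)⁻¹)) * qPochhammerInf (q / a) q := by
        induction m with
        | zero => simp
        | succ m ih =>
          have e : q / a * q ^ (-((m + 1 : ℕ) : ℤ)) * q = q / a * q ^ (-(m : ℤ)) := by
            rw [mul_assoc, ← zpow_add_one₀ hq]; congr 2; push_cast; ring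
          rw [qPochhammerInf_eq_mul hq1, e, Finset.prod_range_succ,
            mul_right_comm _ _ (qPochhammerInf (q / a) q), ← ih, show q / a * q ^ (-((m + 1 : ℕ) : ℤ)) = a⁻¹ * (q ^ m)⁻¹ by
              rw [zpow_neg, zpow_natCast, pow_succ]; field_simp]
          field_simp
          ring
      have e2 : q ^ (3 * (m : ℤ) ^ 2 - m) = q ^ (2 * m ^ 2 + m * (m - 1)) := by
        rw [← zpow_natCast]
        congr 1
        cases m with
        | zero => simp
        | succ m => rw [Nat.add_sub_cancel]; push_cast; ring
      have e3 : a ^ (3 * (m : ℤ)) = a ^ (2 * m) * a ^ m := by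
        rw [← pow_add, ← zpow_natCast]; congr 1; push_cast; ring
      have e4 : q ^ (2 * (m : ℤ)) = q ^ (2 * m) := by norm_cast
      rw [wellPoisedTerm, truncatedWellPoisedTerm, one_mul, e2, e3, e4, zpow_natCast]
      linear_combination ((1 - a * q ^ (2 * m)) * a ^ (2 * m) * q ^ (2 * m ^ 2 + m * (m - 1)) *
        qPochhammerInf (q * q ^ m) q) * e1
    · intro n hn
      rw [wellPoisedTerm, one_mul, qPochhammerInf_mul_zpow_of_neg hq0 hq1 hn, mul_zero, mul_zero]
  rw [bilateralDefect, h1, h2, thetaProd, truncatedDefect]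
  ring

/-- By dominated convergence only the terms of index 0 survive at a = 0, and both equal (q;q)_∞. -/
theorem tendsto_truncatedDefect {q : ℂ} (hq0 : 0 < ‖q‖) (hq1 : ‖q‖ < 1) :
    Tendsto (truncatedDefect q) (𝓝 0) (𝓝 0) := by
  have hq : q ≠ 0 := norm_pos_iff.mp hq0
  obtain ⟨C, hC⟩ := (isCompact_closedBall (0 : ℂ) 1).exists_bound_of_continuousOn
    (continuous_qPochhammerInf hq1).continuousOn
  have hC' : ∀ m : ℕ, ‖qPochhammerInf (q * q ^ m) q‖ ≤ C := fun m => hC _ (by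
    rw [mem_closedBall_zero_iff, ← pow_succ', norm_pow]
    exact pow_le_one₀ hq0.le hq1.le)
  have hC0 : 0 ≤ C := (norm_nonneg _).trans (hC' 0)
  have hball : ∀ᶠ a in 𝓝 (0 : ℂ), ‖a‖ ≤ 1 := by
    filter_upwards [Metric.closedBall_mem_nhds (0 : ℂ) one_pos] with a ha
    simpa using ha
  have t1 : Tendsto (fun a => ∑' n, truncatedTerm q a n) (𝓝 0) (𝓝 (∑' n, truncatedTerm q 0 n)) := by
    refine tendsto_tsum_of_dominated_convergence (bound := fun n => 1 ^ n * ‖q‖ ^ (n ^ 2) * C)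
      ((summable_pow_mul_sq hq0.le hq1 1 zero_le_one).mul_right C) (fun n => ?_) ?_
    · have : Continuous fun a => truncatedTerm q a n := by unfold truncatedTerm; fun_prop
      exact this.tendsto 0
    · filter_upwards [hball] with a ha n
      rw [truncatedTerm, norm_mul, norm_mul, norm_pow, norm_pow, mul_comm (_ ^ _)]
      gcongr
      exact hC' n
  have t2 : Tendsto (fun a => ∑' n, truncatedWellPoisedTerm q a n) (𝓝 0)
      (𝓝 (∑' n, truncatedWellPoisedTerm q 0 n)) := by
    refine tendsto_tsum_of_dominated_convergence (bound := fun n => 2 ^ n * ‖q‖ ^ (n ^ 2) * (2 * C))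
      ((summable_pow_mul_sq hq0.le hq1 2 zero_le_two).mul_right _) (fun n => ?_) ?_
    · have : Continuous fun a => truncatedWellPoisedTerm q a n := by
        unfold truncatedWellPoisedTerm; fun_prop
      exact this.tendsto 0
    · filter_upwards [hball] with a ha m
      have b1 : ‖1 - a * q ^ (2 * m)‖ ≤ 2 := by
        refine (norm_sub_le _ _).trans ?_
        rw [norm_one, norm_mul, norm_pow]
        have := mul_le_one₀ ha (by positivity) (pow_le_one₀ (n := 2 * m) hq0.le hq1.le)
        linarith
      have b2 : ‖a ^ (2 * m)‖ ≤ 1 := by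
        rw [norm_pow]; exact pow_le_one₀ (norm_nonneg _) ha
      -- This costs |q|^(-m²), which the factor |q|^(2m²) outweighs.
      have b3 : ‖∏ k ∈ Finset.range m, (a - (q ^ k)⁻¹)‖ ≤ (2 * (‖q‖ ^ m)⁻¹) ^ m := by
        rw [norm_prod]
        refine (Finset.prod_le_prod (fun _ _ => norm_nonneg _) fun k hk => ?_).trans_eq
          (Finset.prod_const _ |>.trans (by rw [Finset.card_range]))
        have hk' := (Finset.mem_range.mp hk).le
        have h1 : (1 : ℝ) ≤ (‖q‖ ^ m)⁻¹ :=
          (one_le_inv₀ (by positivity)).mpr (pow_le_one₀ hq0.le hq1.le)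
        have h2 : (‖q‖ ^ k)⁻¹ ≤ (‖q‖ ^ m)⁻¹ := by
          gcongr 1
          exact pow_le_pow_of_le_one hq0.le hq1.le hk'
        refine (norm_sub_le _ _).trans ?_
        rw [norm_inv, norm_pow]
        linarith
      rw [truncatedWellPoisedTerm, norm_mul, norm_mul, norm_mul, norm_mul, norm_pow q]
      calc _ ≤ 2 * 1 * ‖q‖ ^ (2 * m ^ 2 + m * (m - 1)) * (2 * (‖q‖ ^ m)⁻¹) ^ m * C := by
            gcongr; exact hC' m
        _ = 2 ^ m * ‖q‖ ^ (m ^ 2) * (2 * C) * ‖q‖ ^ (m * (m - 1)) := by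
            rw [mul_pow, inv_pow, ← pow_mul, pow_add, ← pow_two, pow_mul' ‖q‖ 2]
            field_simp
        _ ≤ _ := mul_le_of_le_one_right (by positivity) (pow_le_one₀ hq0.le hq1.le)
  have t3 : Tendsto (fun a => qPochhammerInf a q) (𝓝 0) (𝓝 (qPochhammerInf 0 q)) :=
    (continuous_qPochhammerInf hq1).tendsto 0
  have s1 : ∑' n, truncatedTerm q 0 n = qPochhammerInf q q := by
    rw [tsum_eq_single 0 fun n hn => by simp [truncatedTerm, hn]]
    simp [truncatedTerm]
  have s2 : ∑' n, truncatedWellPoisedTerm q 0 n = qPochhammerInf q q := by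
    rw [tsum_eq_single 0 fun n hn => by simp [truncatedWellPoisedTerm, hn]]
    simp [truncatedWellPoisedTerm]
  have := (t3.mul t1).sub t2
  rw [s1, s2, qPochhammerInf_zero, one_mul, sub_self] at this
  exact this

/-- A null sequence with `v n = v (n + 1) + c qⁿ v (n + 2)` vanishes far out. -/
theorem eventually_eq_zero_of_recurrence {q c : ℂ} (hq1 : ‖q‖ < 1) {v : ℕ → ℂ}
    (hv : ∀ n, v n = v (n + 1) + c * q ^ n * v (n + 2)) (hlim : Tendsto v atTop (𝓝 0)) :
    ∃ N, ∀ n, N ≤ n → v n = 0 := by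
  have hsum : Summable fun n : ℕ => ‖c‖ * ‖q‖ ^ n :=
    (summable_geometric_of_lt_one (norm_nonneg _) hq1).mul_left _
  obtain ⟨N, hN⟩ := ((tendsto_sum_nat_add fun n : ℕ => ‖c‖ * ‖q‖ ^ n).eventually_le_const
    (show (0 : ℝ) < 1 / 2 by norm_num)).exists
  have hNn : ∀ n, N ≤ n → ∑' k, ‖c‖ * ‖q‖ ^ (k + n) ≤ 1 / 2 := by
    intro n hn
    refine le_trans (Summable.tsum_le_tsum (fun k => ?_) ((summable_nat_add_iff n).mpr hsum)
      ((summable_nat_add_iff N).mpr hsum)) hN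
    gcongr ?_ * ?_
    exact pow_le_pow_of_le_one (norm_nonneg _) hq1.le (by omega)
  obtain ⟨M, hM⟩ := hlim.norm.bddAbove_range
  have hM' : ∀ n, ‖v n‖ ≤ M := fun n => hM ⟨n, rfl⟩
  have hM0 : 0 ≤ M := (norm_nonneg _).trans (hM' 0)
  -- Telescoping the recurrence to infinity, where v tends to 0, bounds v n by B times a coefficient
  -- tail of size at most 1/2. Iterating forces v n = 0.
  have step : ∀ B : ℝ, 0 ≤ B → (∀ n, N ≤ n → ‖v n‖ ≤ B) → ∀ n, N ≤ n → ‖v n‖ ≤ B / 2 := by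
    intro B hB hb n hn
    have htel : ∀ m, ‖v n - v (n + m)‖ ≤ ∑ k ∈ Finset.range m, ‖c‖ * ‖q‖ ^ (k + n) * B := by
      intro m
      induction m with
      | zero => simp
      | succ m ih =>
        rw [Finset.sum_range_succ]
        calc ‖v n - v (n + (m + 1))‖ = ‖(v n - v (n + m)) + c * q ^ (m + n) * v (n + m + 2)‖ := by
              rw [hv (n + m)]; ring_nf
          _ ≤ _ := by
              refine (norm_add_le _ _).trans (add_le_add ih ?_)
              rw [norm_mul, norm_mul, norm_pow]
              gcongr
              exact hb _ (by omega)
    have hle : ∀ m, ‖v n - v (n + m)‖ ≤ B / 2 := by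
      intro m
      refine (htel m).trans ?_
      rw [← Finset.sum_mul]
      have : ∑ k ∈ Finset.range m, ‖c‖ * ‖q‖ ^ (k + n) ≤ 1 / 2 :=
        (((summable_nat_add_iff n).mpr hsum).sum_le_tsum _ fun _ _ => by positivity).trans (hNn n hn)
      calc _ ≤ 1 / 2 * B := by gcongr
        _ = _ := by ring
    have hlim' : Tendsto (fun m => ‖v n - v (n + m)‖) atTop (𝓝 ‖v n - 0‖) :=
      (tendsto_const_nhds.sub (hlim.comp (tendsto_add_atTop_nat n |>.congr fun m => add_comm m n))).norm
    rw [sub_zero] at hlim'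
    exact le_of_tendsto' hlim' hle
  have hall : ∀ j : ℕ, ∀ n, N ≤ n → ‖v n‖ ≤ M * (1 / 2) ^ j := by
    intro j
    induction j with
    | zero => intro n _; simpa using hM' n
    | succ j ih =>
      intro n hn
      refine (step _ (by positivity) ih n hn).trans_eq ?_
      rw [pow_succ]; ring
  refine ⟨N, fun n hn => ?_⟩
  have hz : Tendsto (fun j : ℕ => M * (1 / 2) ^ j) atTop (𝓝 (M * 0)) :=
    (tendsto_pow_atTop_nhds_zero_of_lt_one (by norm_num) (by norm_num)).const_mul M
  rw [mul_zero] at hz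
  exact norm_le_zero_iff.mp (ge_of_tendsto' hz fun j => hall j n hn)

theorem bilateralDefect_one_eq_zero {q : ℂ} (hq0 : 0 < ‖q‖) (hq1 : ‖q‖ < 1) {a : ℂ} (ha : a ≠ 0) :
    bilateralDefect q a 1 = 0 := by
  have hq : q ≠ 0 := norm_pos_iff.mp hq0
  have han : ∀ n : ℕ, a * q ^ n ≠ 0 := fun n => mul_ne_zero ha (pow_ne_zero n hq)
  have key : ∃ N : ℕ, ∀ n, N ≤ n → bilateralDefect q (a * q ^ n) 1 = 0 := by
    -- On the orbit q^ℤ the theta product vanishes and cannot be divided out, but there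
    -- (q/(aq^n);q)_∞ = 0 for large n already kills the defect.
    by_cases hk : ∃ k : ℤ, a = q ^ k
    · obtain ⟨k, rfl⟩ := hk
      refine ⟨(1 - k).toNat, fun n hn => ?_⟩
      rw [bilateralDefect_one_eq hq0 hq1 (han n)]
      have : q / (q ^ k * q ^ n) = q * q ^ (-(k + n)) := by
        rw [zpow_neg, zpow_add₀ hq, zpow_natCast, div_eq_mul_inv]
      rw [this, qPochhammerInf_mul_zpow_of_neg hq0 hq1 (by omega), zero_mul]
    · push Not at hk
      have hE : ∀ n : ℕ, qPochhammerInf (a * q ^ n) q ≠ 0 := fun n =>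
        qPochhammerInf_ne_zero hq1 fun m hm => hk (-(m + n : ℕ)) (by
          rw [zpow_neg, zpow_natCast, pow_add]
          exact eq_inv_of_mul_eq_one_left (by rw [← hm]; ring))
      have hE' : ∀ n : ℕ, qPochhammerInf (q / (a * q ^ n)) q ≠ 0 := fun n =>
        qPochhammerInf_ne_zero hq1 fun m hm => hk (m + 1 - n) (by
          rw [zpow_sub₀ hq, zpow_add_one₀ hq, zpow_natCast, zpow_natCast]
          have := pow_ne_zero n hq
          field_simp at hm ⊢
          exact hm.symm)
      have hT : ∀ n : ℕ, thetaProd q (a * q ^ n) ≠ 0 := fun n => mul_ne_zero (hE n) (hE' n)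
      set v : ℕ → ℂ := fun n => truncatedDefect q (a * q ^ n) / qPochhammerInf (a * q ^ n) q with hvdef
      have hDv : ∀ n, bilateralDefect q (a * q ^ n) 1 = thetaProd q (a * q ^ n) * v n := by
        intro n
        rw [bilateralDefect_one_eq hq0 hq1 (han n), thetaProd, hvdef]
        have := hE n
        field_simp
      have hv : ∀ n, v n = v (n + 1) + (q * a) * q ^ n * v (n + 2) := by
        intro n
        have h := bilateralDefect_one_recurrence hq0 hq1 (han n)
        rw [show a * q ^ n * q ^ 2 = a * q ^ (n + 2) by ring,
          show a * q ^ n * q = a * q ^ (n + 1) by ring, hDv, hDv, hDv,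
          thetaProd_mul hq0 hq1 (han n), show a * q ^ n * q = a * q ^ (n + 1) by ring,
          thetaProd_mul hq0 hq1 (han (n + 1)), show a * q ^ (n + 1) * q = a * q ^ (n + 2) by ring] at h
        have h1 := hT (n + 2)
        have h2 := han n
        have h3 := han (n + 1)
        refine mul_left_cancel₀ (mul_ne_zero (mul_ne_zero h2 h3) h1) ?_
        linear_combination h
      have hlim0 : Tendsto (fun n : ℕ => a * q ^ n) atTop (𝓝 0) := by
        simpa using (tendsto_pow_atTop_nhds_zero_of_norm_lt_one hq1).const_mul a
      have hlim : Tendsto v atTop (𝓝 0) := by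
        have h1 := (tendsto_truncatedDefect hq0 hq1).comp hlim0
        have h2 := ((continuous_qPochhammerInf hq1).tendsto 0).comp hlim0
        rw [qPochhammerInf_zero] at h2
        have := h1.div h2 one_ne_zero
        rwa [zero_div] at this
      obtain ⟨N, hN⟩ := eventually_eq_zero_of_recurrence hq1 hv hlim
      exact ⟨N, fun n hn => by rw [hDv, hN n hn, mul_zero]⟩
  obtain ⟨N, hN⟩ := key
  -- The recurrence expresses the defect at aq^n through those at aq^(n+1) and aq^(n+2), so the
  -- zeros propagate down to n = 0.
  induction N with
  | zero => simpa using hN 0 le_rfl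
  | succ N ih =>
    refine ih fun n hn => ?_
    rw [bilateralDefect_one_recurrence hq0 hq1 (han n),
      show a * q ^ n * q ^ 2 = a * q ^ (n + 2) by ring,
      show a * q ^ n * q = a * q ^ (n + 1) by ring, hN _ (by omega), hN _ (by omega)]
    ring

/-! ### From x = 1 to all x by analytic continuation -/

theorem bilateralDefect_pow_eq_zero {q : ℂ} (hq0 : 0 < ‖q‖) (hq1 : ‖q‖ < 1) (k : ℕ) :
    ∀ {a : ℂ}, a ≠ 0 → bilateralDefect q a (q ^ k) = 0 := by
  have hq : q ≠ 0 := norm_pos_iff.mp hq0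
  induction k with
  | zero => intro a ha; simpa using bilateralDefect_one_eq_zero hq0 hq1 ha
  | succ k ih =>
    intro a ha
    have ha' : a / q ^ 2 ≠ 0 := div_ne_zero ha (pow_ne_zero 2 hq)
    have h := bilateralDefect_shift hq0 hq1 ha' (q ^ k)
    rw [ih ha', div_mul_cancel₀ _ (pow_ne_zero 2 hq), ← pow_succ, eq_comm] at h
    exact (mul_eq_zero.mp h).resolve_left (mul_ne_zero (pow_ne_zero 2 hq) (pow_ne_zero 3 ha'))

theorem differentiable_bilateralDefect {q : ℂ} (hq0 : 0 < ‖q‖) (hq1 : ‖q‖ < 1) (a : ℂ) :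
    Differentiable ℂ (bilateralDefect q a) := by
  intro x₀
  have hE := differentiable_qPochhammerInf hq1
  have hopen : IsOpen (Metric.ball (0 : ℂ) (‖x₀‖ + 1)) := Metric.isOpen_ball
  have hmem : Metric.ball (0 : ℂ) (‖x₀‖ + 1) ∈ 𝓝 x₀ := hopen.mem_nhds (by simp)
  have hA : 0 ≤ max ‖a‖ ‖a⁻¹‖ := by positivity
  obtain ⟨u, hu, hub⟩ := exists_summable_bound_bilateralTerm hq0 hq1 _ (‖x₀‖ + 1) hA
  obtain ⟨w, hw, hwb⟩ := exists_summable_bound_wellPoisedTerm hq0 hq1 _ (‖x₀‖ + 1) hA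
  have d1 := Complex.differentiableOn_tsum_of_summable_norm (F := fun n x => bilateralTerm q a x n) hu
    (fun n => by
      unfold bilateralTerm
      exact ((hE.comp (f := fun x : ℂ => x * q * q ^ n) (by fun_prop)).const_mul _).differentiableOn)
    hopen (fun n x hx => hub a x (le_max_left _ _) (le_max_right _ _)
      (by simpa using (Metric.mem_ball.mp hx).le) n)
  have d2 := Complex.differentiableOn_tsum_of_summable_norm (F := fun n x => wellPoisedTerm q a x n) hw
    (fun n => by
      unfold wellPoisedTerm
      exact (((hE.comp (f := fun x : ℂ => x * q / a * q ^ (-n)) (by fun_prop)).mul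
        (hE.comp (f := fun x : ℂ => x * q * q ^ n) (by fun_prop))).const_mul _).differentiableOn)
    hopen (fun n x hx => (hwb a x (le_max_left _ _) (le_max_right _ _)
      (by simpa using (Metric.mem_ball.mp hx).le) n).2)
  exact ((d1.differentiableAt hmem).const_mul _).sub (d2.differentiableAt hmem)

/-- A bilateral, very-well-poised transformation, a limiting case of the bilateral Bailey lemma. -/
theorem thetaProd_mul_bilateralSum {q : ℂ} (hq0 : 0 < ‖q‖) (hq1 : ‖q‖ < 1) {a : ℂ} (ha : a ≠ 0)
    (x : ℂ) : thetaProd q a * bilateralSum q a x = wellPoisedSum q a x := by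
  have hq : q ≠ 0 := norm_pos_iff.mp hq0
  have hd := differentiable_bilateralDefect hq0 hq1 a
  have han : AnalyticOnNhd ℂ (bilateralDefect q a) Set.univ := fun z _ =>
    (hd.differentiableOn.analyticOnNhd isOpen_univ) z trivial
  have hlim : Tendsto (fun k : ℕ => q ^ k) atTop (𝓝[≠] 0) :=
    tendsto_nhdsWithin_iff.mpr ⟨tendsto_pow_atTop_nhds_zero_of_norm_lt_one hq1,
      .of_forall fun k => pow_ne_zero k hq⟩
  have hfreq : ∃ᶠ z in 𝓝[≠] (0 : ℂ), bilateralDefect q a z = 0 :=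
    hlim.frequently (Frequently.of_forall fun k => bilateralDefect_pow_eq_zero hq0 hq1 k ha)
  have := han.eqOn_zero_of_preconnected_of_frequently_eq_zero isPreconnected_univ (Set.mem_univ 0)
    hfreq (Set.mem_univ x)
  exact sub_eq_zero.mp this

/-! ### Specialisation to theta-type series -/

theorem thetaProd_eq_zpow_mul {q : ℂ} (hq0 : 0 < ‖q‖) (hq1 : ‖q‖ < 1) {w : ℂ} (hw : w ≠ 0) (r : ℤ) :
    (-w) ^ r * q ^ (r * (r - 1) / 2) * thetaProd q (w * q ^ r) = thetaProd q w := by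
  have hq : q ≠ 0 := norm_pos_iff.mp hq0
  have step : ∀ r : ℤ, (-w) ^ (r + 1) * q ^ ((r + 1) * (r + 1 - 1) / 2) * thetaProd q (w * q ^ (r + 1))
      = (-w) ^ r * q ^ (r * (r - 1) / 2) * thetaProd q (w * q ^ r) := by
    intro r
    rw [thetaProd_mul hq0 hq1 (mul_ne_zero hw (zpow_ne_zero r hq)),
      show (r + 1) * (r + 1 - 1) = r * (r - 1) + r * 2 by ring,
      Int.add_mul_ediv_right _ _ two_ne_zero, zpow_add₀ hq, zpow_add_one₀ (neg_ne_zero.mpr hw),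
      mul_assoc w, ← zpow_add_one₀ hq]
    ring
  induction r with
  | zero => simp
  | succ n ih => rw [step, ih]
  | pred n ih => rw [← step, sub_add_cancel, ih]

theorem norm_zpow_half_le {q : ℂ} (hq0 : 0 < ‖q‖) (hq1 : ‖q‖ < 1) {c : ℤ} (hc : |c| ≤ 3) (n : ℤ) :
    ‖q ^ (n * (5 * n + c) / 2)‖ ≤ ‖q‖ ^ (n.natAbs ^ 2) := by
  have h : n ^ 2 ≤ n * (5 * n + c) / 2 := by
    rw [Int.le_ediv_iff_mul_le two_pos]
    obtain ⟨h1, h2⟩ := abs_le.mp hc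
    rcases le_or_gt n 0 with hn | hn
    · rcases hn.eq_or_lt with rfl | hn
      · simp
      · nlinarith
    · nlinarith
  rw [norm_zpow, ← zpow_natCast ‖q‖, Nat.cast_pow, Int.natAbs_sq]
  exact zpow_le_zpow_right_of_le_one₀ hq0 hq1.le h

/-- The series `∑ q^{n(5n+c)/2} b^{5n+d}` is dominated on annuli. -/
theorem exists_summable_bound_theta {q : ℂ} (hq0 : 0 < ‖q‖) (hq1 : ‖q‖ < 1) {c : ℤ} (hc : |c| ≤ 3)
    (A : ℝ) (hA : 1 ≤ A) (l d : ℤ) :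
    ∃ u : ℤ → ℝ, Summable u ∧ ∀ b : ℂ, ‖b‖ ≤ A → ‖b⁻¹‖ ≤ A →
      ∀ n, ‖q ^ (n * (5 * n + c) / 2) * b ^ (l * n + d)‖ ≤ u n := by
  refine ⟨fun n => A ^ d.natAbs * ((A ^ l.natAbs) ^ n.natAbs * ‖q‖ ^ (n.natAbs ^ 2)),
    (summable_pow_natAbs_mul_sq hq0.le hq1 _ (by positivity)).mul_left _, fun b h1 h2 n => ?_⟩
  have e : ‖b ^ (l * n + d)‖ ≤ (A ^ l.natAbs) ^ n.natAbs * A ^ d.natAbs := by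
    refine (norm_zpow_le_pow_natAbs h1 h2 _).trans ?_
    rw [← pow_mul, ← Int.natAbs_mul, ← pow_add]
    exact pow_le_pow_right₀ hA (Int.natAbs_add_le _ _)
  rw [norm_mul]
  calc _ ≤ ‖q‖ ^ (n.natAbs ^ 2) * ((A ^ l.natAbs) ^ n.natAbs * A ^ d.natAbs) := by
        gcongr; exact norm_zpow_half_le hq0 hq1 hc n
    _ = _ := by ring

theorem summable_theta {q : ℂ} (hq0 : 0 < ‖q‖) (hq1 : ‖q‖ < 1) {c : ℤ} (hc : |c| ≤ 3)
    (b : ℂ) (l d : ℤ) :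
    Summable fun n : ℤ => q ^ (n * (5 * n + c) / 2) * b ^ (l * n + d) := by
  obtain ⟨u, hu, h⟩ := exists_summable_bound_theta hq0 hq1 hc (max 1 (max ‖b‖ ‖b⁻¹‖))
    (le_max_left _ _) l d
  exact hu.of_norm_bounded (h b (by simp) (by simp))

theorem ediv_two_add {m k n : ℤ} (h : m + k * 2 = n) : n / 2 = m / 2 + k := by
  rw [← h, Int.add_mul_ediv_right _ _ two_ne_zero]

theorem sub_mul_pred_ediv_two (r : ℤ) : (3 * r ^ 2 - r) - r * (r - 1) / 2 = r * (5 * r - 1) / 2 := by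
  obtain ⟨k, hk⟩ := Int.even_mul_pred_self r
  rw [show r * (5 * r - 1) = (k * 5 + r * 2) * 2 by linear_combination 5 * hk,
    show r * (r - 1) = k * 2 by linear_combination hk, Int.mul_ediv_cancel _ two_ne_zero,
    Int.mul_ediv_cancel _ two_ne_zero]
  linear_combination 3 * hk

/-- The factor 1 + bq^r of 1 - b²q^(2r) completes the two infinite products to θ(-bq^r), which
quasi-periodicity reduces to θ(-b); the factor 1 - bq^r leaves the difference. -/
theorem wellPoisedTerm_sq {q : ℂ} (hq0 : 0 < ‖q‖) (hq1 : ‖q‖ < 1) {b : ℂ} (hb : b ≠ 0) (r : ℤ) :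
    wellPoisedTerm q (b ^ 2) (-b) r = thetaProd q (-b) *
      (q ^ (r * (5 * r + -1) / 2) * b ^ (5 * r + 0) - q ^ (r * (5 * r + 1) / 2) * b ^ (5 * r + 1)) := by
  have hq : q ≠ 0 := norm_pos_iff.mp hq0
  have hz : b * q ^ r ≠ 0 := mul_ne_zero hb (zpow_ne_zero r hq)
  have hzr : q ^ r ≠ 0 := zpow_ne_zero r hq
  have h := thetaProd_eq_zpow_mul hq0 hq1 (neg_ne_zero.mpr hb) r
  rw [neg_neg, neg_mul] at h
  have e1 : -b * q / b ^ 2 * q ^ (-r) = q / -(b * q ^ r) := by rw [zpow_neg]; field_simp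
  have e2 : qPochhammerInf (-(b * q ^ r)) q = (1 + b * q ^ r) * qPochhammerInf (-b * q * q ^ r) q := by
    rw [qPochhammerInf_eq_mul hq1]; ring_nf
  have e3 : (1 - b ^ 2 * q ^ (2 * r)) = (1 - b * q ^ r) * (1 + b * q ^ r) := by
    rw [mul_comm 2 r, zpow_mul]; norm_cast; ring
  have e4 : q ^ (r * (5 * r + 1) / 2) = q ^ (r * (5 * r - 1) / 2) * q ^ r := by
    rw [ediv_two_add (show r * (5 * r - 1) + r * 2 = r * (5 * r + 1) by ring), zpow_add₀ hq]
  have e5 : q ^ (r * (5 * r - 1) / 2) * q ^ (r * (r - 1) / 2) = q ^ (3 * r ^ 2 - r) := by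
    rw [← sub_mul_pred_ediv_two, ← zpow_add₀ hq, sub_add_cancel]
  have e6 : (b ^ 2) ^ (3 * r) = b ^ (5 * r) * b ^ r := by
    rw [← zpow_natCast, ← zpow_mul, ← zpow_add₀ hb]; congr 1; push_cast; ring
  rw [wellPoisedTerm, e1, e3, ← sub_eq_add_neg, add_zero, zpow_add_one₀ hb, e4, ← h, thetaProd, e2,
    ← e5, e6]
  ring

/-- Here the products already form θ(-bq^(r+1)), so the well-poised factor itself gives the
difference. The exponent in -1 - r prepares a reflection of the summation index. -/
theorem wellPoisedTerm_sq_mul {q : ℂ} (hq0 : 0 < ‖q‖) (hq1 : ‖q‖ < 1) {b : ℂ} (hb : b ≠ 0) (r : ℤ) :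
    b ^ 4 * wellPoisedTerm q (b ^ 2 * q) (-b) r = thetaProd q (-b) *
      (q ^ (r * (5 * r + 3) / 2) * b ^ (5 * r + 3) -
        q ^ ((-1 - r) * (5 * (-1 - r) + 3) / 2) * b ^ (5 * r + 5)) := by
  have hq : q ≠ 0 := norm_pos_iff.mp hq0
  have hz : b * q ^ r ≠ 0 := mul_ne_zero hb (zpow_ne_zero r hq)
  have hzr : q ^ r ≠ 0 := zpow_ne_zero r hq
  have h := thetaProd_eq_zpow_mul hq0 hq1 (neg_ne_zero.mpr hb) (r + 1)
  rw [neg_neg] at h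
  have e0 : -b * q ^ (r + 1) = -b * q * q ^ r := by rw [zpow_add_one₀ hq]; ring
  have e1 : -b * q / (b ^ 2 * q) * q ^ (-r) = q / (-b * q * q ^ r) := by rw [zpow_neg]; field_simp
  have e3 : q ^ (2 * r) = (q ^ r) ^ 2 := by rw [mul_comm 2 r, zpow_mul]; norm_cast
  have e4 : q ^ ((-1 - r) * (5 * (-1 - r) + 3) / 2) =
      q ^ (r * (5 * r + 3) / 2) * ((q ^ r) ^ 2 * q) := by
    rw [ediv_two_add (show r * (5 * r + 3) + (2 * r + 1) * 2 = (-1 - r) * (5 * (-1 - r) + 3) by ring),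
      zpow_add₀ hq, zpow_add_one₀ hq, e3]
  have e5 : q ^ (r * (5 * r + 3) / 2) * q ^ ((r + 1) * (r + 1 - 1) / 2) =
      q ^ (3 * r ^ 2 - r) * (q ^ r) ^ 3 := by
    rw [ediv_two_add (show r * (5 * r - 1) + (2 * r) * 2 = r * (5 * r + 3) by ring),
      ediv_two_add (show r * (r - 1) + r * 2 = (r + 1) * (r + 1 - 1) by ring), ← sub_mul_pred_ediv_two,
      ← zpow_add₀ hq, ← zpow_natCast, ← zpow_mul, ← zpow_add₀ hq]
    congr 1; push_cast; ring
  have e6 : (b ^ 2 * q) ^ (3 * r) = b ^ (5 * r) * b ^ r * (q ^ r) ^ 3 := by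
    rw [mul_zpow, ← zpow_natCast, ← zpow_natCast, ← zpow_mul, ← zpow_mul, ← zpow_add₀ hb]
    congr 2 <;> (push_cast; ring)
  have e7 : b ^ (5 * r + 3) = b ^ (5 * r) * b ^ 3 := by rw [zpow_add₀ hb]; norm_cast
  have e8 : b ^ (5 * r + 5) = b ^ (5 * r) * b ^ 5 := by rw [zpow_add₀ hb]; norm_cast
  rw [wellPoisedTerm, e1, e3, e6, e7, e8, e4, ← h, e0, zpow_add_one₀ hb, thetaProd]
  linear_combination (-(1 - b ^ 2 * q * (q ^ r) ^ 2) * b ^ (5 * r) * b ^ r * b ^ 4 *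
    qPochhammerInf (-b * q * q ^ r) q * qPochhammerInf (q / (-b * q * q ^ r)) q) * e5

/-- General term of the theta-type series whose derivative at `b = 1` has the weights
`10 n + 2 j + 1`. -/
noncomputable def oddThetaTerm (q : ℂ) (j : ℕ) (b : ℂ) (n : ℤ) : ℂ :=
  q ^ (n * (5 * n + (2 * j + 1)) / 2) * b ^ (5 * n + (2 * j + 1)) -
    q ^ (n * (5 * n + (2 * j + 1)) / 2) * b ^ (-5 * n + 0)

theorem thetaProd_mul_bilateralSum_eq_oddTheta {q : ℂ} (hq0 : 0 < ‖q‖) (hq1 : ‖q‖ < 1) {j : ℕ}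
    (hj : j = 0 ∨ j = 1) {b : ℂ} (hb : b ≠ 0) :
    b ^ (2 * j) * (thetaProd q (b ^ 2) * bilateralSum q (b ^ 2 * q ^ j) (-b)) =
      -(thetaProd q (-b) * ∑' n, oddThetaTerm q j b n) := by
  have hq : q ≠ 0 := norm_pos_iff.mp hq0
  have hb2 : b ^ 2 ≠ 0 := pow_ne_zero 2 hb
  have hs : ∀ {c : ℤ}, |c| ≤ 3 → ∀ l d, Summable fun n : ℤ =>
      q ^ (n * (5 * n + c) / 2) * b ^ (l * n + d) := fun hc => summable_theta hq0 hq1 hc b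
  rcases hj with rfl | rfl
  · rw [mul_zero, pow_zero, one_mul, pow_zero, mul_one, thetaProd_mul_bilateralSum hq0 hq1 hb2,
      wellPoisedSum, tsum_congr (wellPoisedTerm_sq hq0 hq1 hb), tsum_mul_left, ← mul_neg]
    congr 1
    simp only [oddThetaTerm, Nat.cast_zero, mul_zero, zero_add]
    rw [(hs (by norm_num) _ _).tsum_sub (hs (by norm_num) _ _),
      (hs (by norm_num) _ _).tsum_sub (hs (by norm_num) _ _), neg_sub]
    congr 1
    -- The reflection r → -r turns 5r - 1 into 5r + 1; for j = 1 its role is played by r → -1 - r.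
    rw [← (Equiv.neg ℤ).tsum_eq]
    refine tsum_congr fun r => ?_
    rw [Equiv.neg_apply]
    congr 2 <;> ring_nf
  · have hT := thetaProd_mul hq0 hq1 hb2
    have hw := thetaProd_mul_bilateralSum hq0 hq1 (mul_ne_zero hb2 hq) (-b)
    have hw' : b ^ 4 * wellPoisedSum q (b ^ 2 * q) (-b) =
        thetaProd q (-b) * ∑' n, oddThetaTerm q 1 b n := by
      rw [wellPoisedSum, ← tsum_mul_left, tsum_congr (wellPoisedTerm_sq_mul hq0 hq1 hb), tsum_mul_left]
      congr 1
      simp only [oddThetaTerm, Nat.cast_one, mul_one, show (2 : ℤ) + 1 = 3 by norm_num]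
      have hre : (fun r : ℤ => q ^ ((-1 - r) * (5 * (-1 - r) + 3) / 2) * b ^ (5 * r + 5)) =
          (fun r : ℤ => q ^ (r * (5 * r + 3) / 2) * b ^ (-5 * r + 0)) ∘ (Equiv.subLeft (-1 : ℤ)) := by
        ext r
        simp only [Function.comp, Equiv.subLeft_apply]
        congr 2; ring
      have hs2 : Summable fun r : ℤ =>
          q ^ ((-1 - r) * (5 * (-1 - r) + 3) / 2) * b ^ (5 * r + 5) := by
        rw [hre]
        exact (Equiv.summable_iff _).mpr (hs (by norm_num) _ _)
      rw [(hs (by norm_num) _ _).tsum_sub hs2,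
        (hs (by norm_num) _ _).tsum_sub (hs (by norm_num) _ _), hre]
      congr 1
      exact (Equiv.subLeft (-1 : ℤ)).tsum_eq (fun r : ℤ => q ^ (r * (5 * r + 3) / 2) * b ^ (-5 * r + 0))
    rw [hT, ← hw', ← hw]
    ring_nf

/-! ### Differentiation at b = 1 -/

theorem norm_le_two_of_mem_ball {b : ℂ} (hb : b ∈ Metric.ball (1 : ℂ) (1 / 2)) :
    ‖b‖ ≤ 2 ∧ ‖b⁻¹‖ ≤ 2 ∧ b ≠ 0 := by
  rw [mem_ball_iff_norm] at hb
  have h1 : ‖b‖ ≤ ‖b - 1‖ + ‖(1 : ℂ)‖ := by simpa using norm_add_le (b - 1) 1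
  have h2 : ‖(1 : ℂ)‖ ≤ ‖b‖ + ‖b - 1‖ := by simpa using norm_sub_le b (b - 1)
  rw [norm_one] at h1 h2
  have h3 : 1 / 2 ≤ ‖b‖ := by linarith
  refine ⟨by linarith, ?_, norm_pos_iff.mp (by linarith)⟩
  rw [norm_inv, inv_le_comm₀ (by linarith) two_pos]
  linarith

/-- Termwise differentiation is legitimate by the uniform majorants; the weight is the difference of
exponents (5n + 2j + 1) - (-5n). -/
theorem hasSum_oddTheta_deriv {q : ℂ} (hq0 : 0 < ‖q‖) (hq1 : ‖q‖ < 1) {j : ℕ}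
    (hj : j = 0 ∨ j = 1) :
    DifferentiableAt ℂ (fun b => ∑' n, oddThetaTerm q j b n) 1 ∧
    HasSum (fun n : ℤ => q ^ (n * (5 * n + 2 * (j : ℤ) + 1) / 2) *
        (10 * (n : ℂ) + 2 * (j : ℂ) + 1)) (deriv (fun b => ∑' n, oddThetaTerm q j b n) 1) := by
  have hc : |(2 * (j : ℤ) + 1)| ≤ 3 := by rcases hj with rfl | rfl <;> norm_num
  obtain ⟨u, hu, hub⟩ := exists_summable_bound_theta hq0 hq1 hc 2 one_le_two 5 (2 * j + 1)
  obtain ⟨w, hw, hwb⟩ := exists_summable_bound_theta hq0 hq1 hc 2 one_le_two (-5) 0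
  have hopen : IsOpen (Metric.ball (1 : ℂ) (1 / 2)) := Metric.isOpen_ball
  have hmem : (1 : ℂ) ∈ Metric.ball (1 : ℂ) (1 / 2) := by simp
  have hdiff : ∀ n : ℤ, DifferentiableOn ℂ (fun b => oddThetaTerm q j b n)
      (Metric.ball (1 : ℂ) (1 / 2)) := by
    intro n b hb
    have hb0 := (norm_le_two_of_mem_ball hb).2.2
    unfold oddThetaTerm
    exact (((differentiableAt_zpow.mpr (Or.inl hb0)).const_mul _).sub
      ((differentiableAt_zpow.mpr (Or.inl hb0)).const_mul _)).differentiableWithinAt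
  have hbound : ∀ (n : ℤ) (b : ℂ), b ∈ Metric.ball (1 : ℂ) (1 / 2) →
      ‖oddThetaTerm q j b n‖ ≤ u n + w n := fun n b hb =>
    (norm_sub_le _ _).trans (add_le_add
      (hub b (norm_le_two_of_mem_ball hb).1 (norm_le_two_of_mem_ball hb).2.1 n)
      (hwb b (norm_le_two_of_mem_ball hb).1 (norm_le_two_of_mem_ball hb).2.1 n))
  refine ⟨(Complex.differentiableOn_tsum_of_summable_norm (hu.add hw) hdiff hopen
    hbound).differentiableAt (hopen.mem_nhds hmem), ?_⟩
  refine (Complex.hasSum_deriv_of_summable_norm (hu.add hw) hdiff hopen hbound hmem).congr_fun ?_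
  intro n
  have h1 := (hasDerivAt_zpow (5 * n + (2 * (j : ℤ) + 1)) (1 : ℂ) (Or.inl one_ne_zero)).const_mul
    (q ^ (n * (5 * n + (2 * j + 1)) / 2))
  have h2 := (hasDerivAt_zpow (-5 * n + 0) (1 : ℂ) (Or.inl one_ne_zero)).const_mul
    (q ^ (n * (5 * n + (2 * j + 1)) / 2))
  have h3 : deriv (fun b => oddThetaTerm q j b n) 1 = _ := (h1.sub h2).deriv
  rw [h3]
  simp only [one_zpow, mul_one, ← add_assoc]
  push_cast
  ring

theorem differentiableAt_bilateralSum {q : ℂ} (hq0 : 0 < ‖q‖) (hq1 : ‖q‖ < 1) (j : ℕ) :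
    DifferentiableAt ℂ (fun b : ℂ => bilateralSum q (b ^ 2 * q ^ j) (-b)) 1 := by
  have hopen : IsOpen (Metric.ball (1 : ℂ) (1 / 2)) := Metric.isOpen_ball
  have hq : q ≠ 0 := norm_pos_iff.mp hq0
  have hE := differentiable_qPochhammerInf hq1
  have hp : 1 ≤ (‖q‖ ^ j)⁻¹ := (one_le_inv₀ (by positivity)).mpr (pow_le_one₀ hq0.le hq1.le)
  obtain ⟨u, hu, hub⟩ := exists_summable_bound_bilateralTerm hq0 hq1 (4 * (‖q‖ ^ j)⁻¹) 2
    (by positivity)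
  refine (Complex.differentiableOn_tsum_of_summable_norm
    (F := fun n (b : ℂ) => bilateralTerm q (b ^ 2 * q ^ j) (-b) n) hu (fun n b hb => ?_) hopen
    (fun n b hb => ?_)).differentiableAt (hopen.mem_nhds (by simp))
  · have hb0 := (norm_le_two_of_mem_ball hb).2.2
    have ha : b ^ 2 * q ^ j ≠ 0 := mul_ne_zero (pow_ne_zero 2 hb0) (pow_ne_zero j hq)
    have d1 : DifferentiableAt ℂ (fun b : ℂ => (b ^ 2 * q ^ j) ^ n) b :=
      DifferentiableAt.zpow (by fun_prop) (Or.inl ha)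
    have d2 : DifferentiableAt ℂ (fun b : ℂ => qPochhammerInf (-b * q * q ^ n) q) b :=
      (hE.comp (f := fun b : ℂ => -b * q * q ^ n) (by fun_prop)) b
    exact ((d1.const_mul _).mul d2).differentiableWithinAt
  · obtain ⟨h1, h2, -⟩ := norm_le_two_of_mem_ball hb
    refine hub _ _ ?_ ?_ (by rwa [norm_neg]) n
    · rw [norm_mul, norm_pow, norm_pow]
      have : ‖b‖ ^ 2 * ‖q‖ ^ j ≤ 2 ^ 2 * 1 := mul_le_mul (by gcongr)
        (pow_le_one₀ hq0.le hq1.le) (by positivity) (by norm_num)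
      linarith
    · rw [mul_inv, norm_mul, ← inv_pow, norm_pow, norm_inv (q ^ j), norm_pow]
      calc _ ≤ 2 ^ 2 * (‖q‖ ^ j)⁻¹ := by gcongr
        _ = _ := by ring

theorem qPochhammerInf_ne_zero_of_norm_lt_one {q : ℂ} (hq1 : ‖q‖ < 1) {y : ℂ} (hy : ‖y‖ < 1) :
    qPochhammerInf y q ≠ 0 := by
  refine qPochhammerInf_ne_zero hq1 fun n h => ?_
  have h' := congrArg norm h
  rw [norm_mul, norm_pow, norm_one] at h'
  have := mul_le_of_le_one_left (norm_nonneg y) (pow_le_one₀ (n := n) (norm_nonneg q) hq1.le)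
  linarith

theorem deriv_oddTheta_eq {q : ℂ} (hq0 : 0 < ‖q‖) (hq1 : ‖q‖ < 1) {j : ℕ} (hj : j = 0 ∨ j = 1) :
    qPochhammerInf (-q) q ^ 2 * deriv (fun b => ∑' n, oddThetaTerm q j b n) 1 =
      qPochhammerInf q q ^ 2 * bilateralSum q (q ^ j) (-1) := by
  have hE := differentiable_qPochhammerInf hq1
  have hΘ := (hasSum_oddTheta_deriv hq0 hq1 hj).1.hasDerivAt
  set Θ : ℂ → ℂ := fun b => ∑' n, oddThetaTerm q j b n with hΘdef
  have hΘ1 : Θ 1 = 0 := by simp [hΘdef, oddThetaTerm]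
  -- The left side of the specialised identity with the simple zero 1 - b² removed; at b = 1 only
  -- g(1) and Θ'(1) enter the product rule.
  set g : ℂ → ℂ := fun b => b ^ (2 * j) * (qPochhammerInf (b ^ 2 * q) q *
    qPochhammerInf (q / b ^ 2) q * bilateralSum q (b ^ 2 * q ^ j) (-b)) with hg
  have hgd : DifferentiableAt ℂ g 1 := by
    have d1 : DifferentiableAt ℂ (fun b : ℂ => qPochhammerInf (b ^ 2 * q) q) 1 :=
      (hE.comp (f := fun b : ℂ => b ^ 2 * q) (by fun_prop)) 1
    have d2 : DifferentiableAt ℂ (fun b : ℂ => qPochhammerInf (q / b ^ 2) q) 1 :=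
      (hE _).comp (f := fun b : ℂ => q / b ^ 2) 1
        (DifferentiableAt.div (by fun_prop) (by fun_prop) (by simp))
    have d3 := differentiableAt_bilateralSum hq0 hq1 j
    exact (by fun_prop : DifferentiableAt ℂ (fun b : ℂ => b ^ (2 * j)) 1).mul ((d1.mul d2).mul d3)
  have hT : DifferentiableAt ℂ (fun b : ℂ => thetaProd q (-b)) 1 := by
    have d1 : DifferentiableAt ℂ (fun b : ℂ => qPochhammerInf (-b) q) 1 :=
      (hE.comp (f := fun b : ℂ => -b) (by fun_prop)) 1
    have d2 : DifferentiableAt ℂ (fun b : ℂ => qPochhammerInf (q / -b) q) 1 :=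
      (hE _).comp (f := fun b : ℂ => q / -b) 1
        (DifferentiableAt.div (by fun_prop) (by fun_prop) (by simp))
    exact d1.mul d2
  have hsq : HasDerivAt (fun b : ℂ => 1 - b ^ 2) (-2) 1 := by
    simpa using (hasDerivAt_pow 2 (1 : ℂ)).const_sub 1
  have hL := hsq.mul hgd.hasDerivAt
  have hR := (hT.hasDerivAt.mul hΘ).neg
  have heq : (fun b : ℂ => (1 - b ^ 2) * g b) =ᶠ[𝓝 1] fun b => -(thetaProd q (-b) * Θ b) := by
    filter_upwards [isOpen_ne.mem_nhds (one_ne_zero (α := ℂ))] with b hb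
    rw [← thetaProd_mul_bilateralSum_eq_oddTheta hq0 hq1 hj hb, hg, thetaProd,
      qPochhammerInf_eq_mul hq1 (b ^ 2)]
    ring
  have h := (hL.congr_of_eventuallyEq heq.symm).unique hR
  have hT1 : thetaProd q (-1) = 2 * qPochhammerInf (-q) q ^ 2 := by
    rw [thetaProd, qPochhammerInf_eq_mul hq1 (-1), div_neg, div_one, neg_one_mul]
    ring
  have hg1 : g 1 = qPochhammerInf q q ^ 2 * bilateralSum q (q ^ j) (-1) := by
    simp only [hg, one_pow, one_mul, div_one]
    ring
  simp only [one_pow, sub_self, zero_mul, add_zero, hΘ1, mul_zero, zero_add, hT1, hg1] at h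
  linear_combination (1 / 2) * h

/-! ### Recovering the mock theta functions -/

theorem qPochhammer_neg_ne_zero {q : ℂ} (hq1 : ‖q‖ < 1) (n : ℕ) : qPochhammer (-q) q n ≠ 0 := by
  have h := qPochhammerInf_ne_zero_of_norm_lt_one hq1 (y := -q) (by rwa [norm_neg])
  rw [qPochhammerInf_eq_qPochhammer_mul hq1 _ n] at h
  exact left_ne_zero_of_mul h

theorem bilateralTerm_natCast {q : ℂ} (hq1 : ‖q‖ < 1) (j n : ℕ) :
    bilateralTerm q (q ^ j) (-1) n = qPochhammerInf (-q) q * mockFTerm j q n := by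
  have h := qPochhammerInf_eq_qPochhammer_mul hq1 (-q) n
  have hne := qPochhammer_neg_ne_zero hq1 n
  rw [bilateralTerm, mockFTerm, h, neg_one_mul, zpow_natCast, zpow_natCast, ← pow_mul, pow_add]
  norm_cast
  field_simp

/-- Each extra factor 1 + q^(-i) becomes 1 + q^i after multiplication by q^i. The factor with i = 0
is the 2 in 2ψ_j. -/
theorem qPochhammerInf_neg_mul_zpow {q : ℂ} (hq0 : 0 < ‖q‖) (hq1 : ‖q‖ < 1) (k : ℕ) :
    qPochhammerInf (-q * q ^ (-((k : ℤ) + 1))) q * q ^ (k + 1).choose 2 =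
      2 * qPochhammer (-q) q k * qPochhammerInf (-q) q := by
  have hq : q ≠ 0 := norm_pos_iff.mp hq0
  induction k with
  | zero =>
    rw [Nat.cast_zero, zero_add, zpow_neg_one, neg_mul, mul_inv_cancel₀ hq,
      qPochhammerInf_eq_mul hq1 (-1), neg_one_mul]
    rw [show Nat.choose (0 + 1) 2 = 0 from rfl, qPochhammer, Finset.range_zero, Finset.prod_empty]
    ring
  | succ k ih =>
    have e : -q * q ^ (-(((k + 1 : ℕ) : ℤ) + 1)) * q = -q * q ^ (-((k : ℤ) + 1)) := by
      rw [mul_assoc, ← zpow_add_one₀ hq]; congr 2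
    have e1 : -q * q ^ (-(((k + 1 : ℕ) : ℤ) + 1)) = -(q ^ (k + 1))⁻¹ := by
      rw [neg_mul, ← zpow_one_add₀ hq, ← zpow_natCast, ← zpow_neg]; congr 2
    have hk : q ^ (k + 1) ≠ 0 := pow_ne_zero _ hq
    have e2 : (k + 1 + 1).choose 2 = (k + 1) + (k + 1).choose 2 := by
      rw [Nat.choose_succ_succ' (k + 1) 1, Nat.choose_one_right]
    have e3 : qPochhammer (-q) q (k + 1) = qPochhammer (-q) q k * (1 + q ^ (k + 1)) := by
      rw [qPochhammer, Finset.prod_range_succ, ← qPochhammer]; ring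
    rw [qPochhammerInf_eq_mul hq1, e, e1, e2, e3, pow_add]
    have : (1 - -(q ^ (k + 1))⁻¹) * q ^ (k + 1) = 1 + q ^ (k + 1) := by field_simp; ring
    linear_combination (qPochhammerInf (-q * q ^ (-((k : ℤ) + 1))) q * q ^ (k + 1).choose 2) * this +
      (1 + q ^ (k + 1)) * ih

/-- The index set of `ψ_j` is a copy of `ℕ`. -/
def mockPsiIndexEquiv {j : ℕ} (hj : j ≤ 1) : ℕ ≃ {n : ℕ // 1 ≤ n + j} where
  toFun k := ⟨k + 1 - j, by omega⟩
  invFun n := n + j - 1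
  left_inv k := by dsimp only; omega
  right_inv n := by
    have := n.2
    ext
    dsimp only
    omega

theorem bilateralTerm_negSucc {q : ℂ} (hq0 : 0 < ‖q‖) (hq1 : ‖q‖ < 1) {j : ℕ} (hj : j ≤ 1) (k : ℕ) :
    bilateralTerm q (q ^ j) (-1) (-((k : ℤ) + 1)) =
      qPochhammerInf (-q) q * (2 * mockPsiTerm j q (mockPsiIndexEquiv hj k)) := by
  have hq : q ≠ 0 := norm_pos_iff.mp hq0
  have h := qPochhammerInf_neg_mul_zpow hq0 hq1 k
  have hc : q ^ (k + 1).choose 2 ≠ 0 := pow_ne_zero _ hq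
  have e1 : k + 1 - j + j - 1 = k := by omega
  -- For j ≤ 1, (k+1)² - j(k+1) is a sum of two triangular numbers: one is the exponent in ψ_j, the
  -- other clears the negative powers in the product.
  have e2 : q ^ ((-((k : ℤ) + 1)) ^ 2) * (q ^ j) ^ (-((k : ℤ) + 1)) =
      q ^ (k + 1 - j + 1).choose 2 * q ^ (k + 1).choose 2 := by
    rw [← zpow_natCast q j, ← zpow_mul, ← zpow_add₀ hq, ← pow_add, ← zpow_natCast]
    congr 1
    have t : ∀ m : ℕ, ((m + 1).choose 2 : ℤ) * 2 = (m + 1) * m := fun m => by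
      have := Nat.add_one_mul_choose_eq m 1
      rw [Nat.choose_one_right] at this
      exact_mod_cast this.symm
    have t1 := t k
    have t2 := t (k + 1)
    interval_cases j
    · rw [Nat.sub_zero]
      push_cast at t2 ⊢
      linarith
    · rw [Nat.add_sub_cancel]
      push_cast
      linarith
  simp only [mockPsiTerm, mockPsiIndexEquiv, Equiv.coe_fn_mk, e1]
  rw [bilateralTerm, neg_one_mul, e2]
  linear_combination q ^ (k + 1 - j + 1).choose 2 * h

theorem corollary1p6 (j : ℕ) (hj : j = 0 ∨ j = 1) (q : ℂ) (hq0 : 0 < ‖q‖) (hq1 : ‖q‖ < 1) :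
    Multipliable (fun n : ℕ => 1 - q ^ n * q) ∧
    Multipliable (fun n : ℕ => 1 - (q ^ 2) ^ n * q) ∧
    (∀ n : ℕ, qPochhammer (-q) q n ≠ 0) ∧
    Summable (mockFTerm j q) ∧
    Summable (mockPsiTerm j q) ∧
    HasSum (fun n : ℤ => q ^ (n * (5 * n + 2 * (j : ℤ) + 1) / 2) *
        (10 * (n : ℂ) + 2 * (j : ℂ) + 1))
      (qPochhammerInf q q ^ 2 * qPochhammerInf q (q ^ 2) * (mockF j q + 2 * mockPsi j q)) := by
  have hq2 : ‖q ^ 2‖ < 1 := by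
    rw [norm_pow]; exact pow_lt_one₀ (norm_nonneg _) hq1 two_ne_zero
  have hj1 : j ≤ 1 := by omega
  have hE : qPochhammerInf (-q) q ≠ 0 := qPochhammerInf_ne_zero_of_norm_lt_one hq1 (by rwa [norm_neg])
  have hs := summable_bilateralTerm hq0 hq1 (q ^ j) (-1)
  have hF : Summable (mockFTerm j q) := by
    have h := hs.comp_injective (Nat.cast_injective (R := ℤ))
    refine (summable_mul_left_iff hE).mp (h.congr fun n => ?_)
    exact bilateralTerm_natCast hq1 j n
  have hneg : Function.Injective fun k : ℕ => -((k : ℤ) + 1) := fun a b h => by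
    simpa using h
  have hP' : Summable fun k => mockPsiTerm j q (mockPsiIndexEquiv hj1 k) := by
    have h := hs.comp_injective hneg
    refine (summable_mul_left_iff (two_ne_zero (α := ℂ))).mp
      ((summable_mul_left_iff hE).mp (h.congr fun n => ?_))
    exact bilateralTerm_negSucc hq0 hq1 hj1 n
  have hP : Summable (mockPsiTerm j q) := (mockPsiIndexEquiv hj1).summable_iff.mp hP'
  have hsum : bilateralSum q (q ^ j) (-1) = qPochhammerInf (-q) q * (mockF j q + 2 * mockPsi j q) := by
    have h1 : HasSum (fun n : ℕ => bilateralTerm q (q ^ j) (-1) n)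
        (qPochhammerInf (-q) q * mockF j q) := by
      simp only [bilateralTerm_natCast hq1]
      exact hF.hasSum.mul_left _
    have h2 : HasSum (fun k : ℕ => bilateralTerm q (q ^ j) (-1) (-((k : ℤ) + 1)))
        (qPochhammerInf (-q) q * (2 * mockPsi j q)) := by
      simp only [bilateralTerm_negSucc hq0 hq1 hj1]
      exact ((((mockPsiIndexEquiv hj1).hasSum_iff).mpr hP.hasSum).mul_left _).mul_left _
    rw [bilateralSum, (h1.of_nat_of_neg_add_one h2).tsum_eq]
    ring
  refine ⟨multipliable_one_sub_pow_mul hq1 q, multipliable_one_sub_pow_mul hq2 q,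
    qPochhammer_neg_ne_zero hq1, hF, hP, ?_⟩
  convert (hasSum_oddTheta_deriv hq0 hq1 hj).2 using 1
  have h := deriv_oddTheta_eq hq0 hq1 hj
  rw [hsum] at h
  have hodd := qPochhammerInf_odd_mul_qPochhammerInf_neg hq1
  -- After scaling by (-q;q)_∞², Euler's identity trades (q;q²)_∞ for one of these two factors.
  refine mul_left_cancel₀ (pow_ne_zero 2 hE) ?_
  rw [h]
  linear_combination (qPochhammerInf q q ^ 2 * qPochhammerInf (-q) q *
    (mockF j q + 2 * mockPsi j q)) * hodd
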